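/- Let $F$ be a free group of finite rank with free basis $A=\{a_1,\dots,a_r\}$. For $g\in F$ let $|g|$ be the least length of a word in $A\cup A^{-1}$ that represents $g$, and let $d_A(g,h)=|g^{-1}h|$ be the word metric on $F$. Then the closest element problem in $F$ is solvable in polynomial time. That is, there is a (multi-tape, or multi-stack) Turing machine that, given words in $A\cup A^{-1}$ (not necessarily reduced) representing elements $g,h_1,\dots,h_n\in F$, where $n\ge 0$ is part of the input, outputs, in a number of steps bounded by a polynomial in the input length, a word in $A\cup A^{-1}$ representing an element $h\in H=\langle h_1,\dots,h_n\rangle$ with $d_A(g,h)\le d_A(g,h')$ for all $h'\in H$. The group $F$ and its basis are fixed (the machine and the polynomial may depend on $r$), and the input length is $|g|_{\mathrm{word}}+\sum_i|h_i|_{\mathrm{word}}+n+1$, where $|\cdot|_{\mathrm{word}}$ is the length of the given word (each word is written down followed by a separator). -/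

import Mathlib

namespace ClosestElement

/-- Words in the alphabet `A ∪ A⁻¹`: the letter `(a, true)` stands for `a` and the letter
`(a, false)` for `a⁻¹`. Words need not be freely reduced. -/
abbrev Word (A : Type) : Type := List (A × Bool)

section Group

variable {A : Type} {G : Type*} [Group G]

/-- The element of `G` represented by a word, where `x : A → G` gives the generators. -/
def eval (x : A → G) (w : Word A) : G :=
  (w.map fun p => if p.2 then x p.1 else (x p.1)⁻¹).prod

/-- The word length of `g`: the least length of a word in the generators and their inverses
that represents `g`. (Meant for `x` whose range generates `G`, so that such a word exists.) -/
noncomputable def wordLength (x : A → G) (g : G) : ℕ :=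
  sInf {n | ∃ w : Word A, eval x w = g ∧ w.length = n}

/-- The (left-invariant) word metric on `G` with respect to the generators `x`. -/
noncomputable def wordDist (x : A → G) (g h : G) : ℕ :=
  wordLength x (g⁻¹ * h)

end Group

/-- An instance of the closest element problem: a word for the element `g`, and a finite list of
words for the generators of the subgroup `H`. -/
structure Instance (A : Type) where
  /-- the word that represents the element -/
  elt : Word A
  /-- the words that represent the generators of the subgroup -/
  gens : List (Word A)

/-- An instance `(g; h₁, …, hₙ)` is written on the tape as `g # h₁ # ⋯ hₙ #`; the separator `#` is
`none`. -/
def Instance.encode {A : Type} (I : Instance A) : List (Option (A × Bool)) :=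
  (I.elt :: I.gens).flatMap fun w => w.map some ++ [none]

section Group

variable {A : Type} {G : Type*} [Group G]

/-- The subgroup `H = ⟨h₁, …, hₙ⟩` of `G` given by an instance. -/
def Instance.subgroup (x : A → G) (I : Instance A) : Subgroup G :=
  Subgroup.closure {h | ∃ w ∈ I.gens, eval x w = h}

/-- The word `w` represents an element of `H` that is closest to `g` in the word metric, among all
the elements of `H`. -/
def IsSolution (x : A → G) (I : Instance A) (w : Word A) : Prop :=
  eval x w ∈ I.subgroup x ∧
    ∀ h ∈ I.subgroup x, wordDist x (eval x I.elt) (eval x w) ≤ wordDist x (eval x I.elt) h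

/-- The closest element problem in the fixed group `G` with the fixed generators `x` is solvable in
polynomial time: some function that is computed by a (multi-stack) Turing machine, in a number of
steps bounded by a polynomial in the length of the encoded instance, sends every instance to a
word for a closest element. -/
def SolvableInPolyTime (x : A → G) : Prop :=
  ∃ f : Instance A → Word A,
    Nonempty (Turing.TM2ComputableInPolyTime (Instance.encode (A := A)) (fun w : Word A => w) f) ∧
      ∀ I : Instance A, IsSolution x I (f I)

end Group

end ClosestElement

/-
Write `H` for the subgroup generated by the words `h₁, …, hₙ`. Take the graph that consists of a
path spelling `g`, from a base vertex to a vertex `e`, and of a loop at the base vertex for each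
`hᵢ`, with an inverse edge for each edge. Fold it: identify the ends of any two edges that have the
same label and start at the same vertex, until this is no longer possible. As in Stallings' theory,
a vertex reached from the base along `w` stands for the coset `H w`, so the labels of paths from `e`
to the base represent elements of `g⁻¹ H`. Conversely, every element of `g⁻¹ H` is represented by
such a label, and also by a freely reduced one, since a path that runs through an edge and its
inverse in turn can be shortened in a folded graph. Hence a shortest path from `e` to the base, with
label `u`, realises the distance from `g` to `H`, and `g u` is a closest element.

The graph has at most `N` vertices, where `N` is the input length plus one, so folding and
breadth-first search can be written as programs whose nested loops all run `N` times, over arrays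
indexed by tuples of numbers below `N`. Such programs run in polynomial time on a multi-stack
machine: a pair of stacks holds an array, with the head position between them.
-/

namespace ClosestElement

open Turing Function StateTransition

/-! ### Bounded-loop programs on stacks -/

/-- Programs that act on a family of stacks over the alphabet `Γ`, indexed by `R`. All loops have
the same number of iterations, a parameter of the execution. -/
inductive StackProg (R Γ : Type) : Type
  | skip : StackProg R Γ
  | push : R → Γ → StackProg R Γ
  | pop : R → StackProg R Γ
  | case : R → (Option Γ → StackProg R Γ) → StackProg R Γ
  | seq : StackProg R Γ → StackProg R Γ → StackProg R Γ
  | loop : StackProg R Γ → StackProg R Γ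

namespace StackProg

variable {R Γ : Type}

/-- The effect of a program on the stacks, where each loop is repeated `n` times. -/
def run [DecidableEq R] (n : ℕ) : StackProg R Γ → (R → List Γ) → R → List Γ
  | skip, S => S
  | push k a, S => update S k (a :: S k)
  | pop k, S => update S k (S k).tail
  | case k f, S => run n (f (S k).head?) S
  | seq P Q, S => run n Q (run n P S)
  | loop P, S => (run n P)^[n] S

/-- A polynomial in the number of loop iterations that bounds the number of machine steps. A loop
of the machine spends one step per iteration on counting down, one on leaving, and then restores
its counter. -/
noncomputable def cost [Fintype Γ] : StackProg R Γ → Polynomial ℕ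
  | skip => 1
  | push _ _ => 1
  | pop _ => 1
  | case _ f => 1 + ∑ o, cost (f o)
  | seq P Q => cost P + cost Q
  | loop P => Polynomial.X * (cost P + 1) + 1 + (Polynomial.X + 1)

theorem eval_cost_le_eval_cost_case [Fintype Γ] (n : ℕ) (k : R) (f : Option Γ → StackProg R Γ)
    (o : Option Γ) : (f o).cost.eval n + 1 ≤ (case k f).cost.eval n := by
  have h : (f o).cost.eval n ≤ ∑ o, (f o).cost.eval n :=
    Finset.single_le_sum (f := fun o => (f o).cost.eval n) (fun _ _ => Nat.zero_le _)
      (Finset.mem_univ o)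
  simp only [cost, Polynomial.eval_add, Polynomial.eval_one, Polynomial.eval_finsetSum]
  lia

theorem length_iterate_le {F : (R → List Γ) → R → List Γ} {d : ℕ}
    (hF : ∀ S k, (F S k).length ≤ (S k).length + d) (m : ℕ) (S : R → List Γ) (k : R) :
    (F^[m] S k).length ≤ (S k).length + m * d := by
  induction m with
  | zero => simp
  | succ m ih =>
    rw [iterate_succ_apply', Nat.succ_mul]
    have := hF (F^[m] S) k
    lia

theorem length_run_le [DecidableEq R] [Fintype Γ] (n : ℕ) (P : StackProg R Γ) (S : R → List Γ)
    (k : R) : (P.run n S k).length ≤ (S k).length + P.cost.eval n := by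
  induction P generalizing S k with
  | skip => simp [run, cost]
  | push r a => rcases eq_or_ne k r with rfl | h <;> simp [run, cost, *]
  | pop r =>
    rcases eq_or_ne k r with rfl | h
    · simp only [run, update_self, List.length_tail]
      lia
    · simp [run, h]
  | case r f ih =>
    have := ih (S r).head? S k
    have := eval_cost_le_eval_cost_case n r f (S r).head?
    simp only [run]
    lia
  | seq P Q ihP ihQ =>
    have := ihP S k
    have := ihQ (P.run n S) k
    simp only [run, cost, Polynomial.eval_add]
    lia
  | loop P ih =>
    have := length_iterate_le ih n S k
    simp only [run, cost, Polynomial.eval_add, Polynomial.eval_mul, Polynomial.eval_X,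
      Polynomial.eval_one, mul_add]
    lia

/-- The labels of the machine code of a program. A loop has a label `inl false` where it counts
down, and a label `inl true` where it restores its counter. -/
def Label : StackProg R Γ → Type
  | skip => Unit
  | push _ _ => Unit
  | pop _ => Unit
  | case _ f => Option (Σ o, Label (f o))
  | seq P Q => Label P ⊕ Label Q
  | loop P => Bool ⊕ Label P

theorem finite_label [Finite Γ] (P : StackProg R Γ) : Finite P.Label := by
  induction P with
  | skip => exact inferInstanceAs (Finite Unit)
  | push _ _ => exact inferInstanceAs (Finite Unit)
  | pop _ => exact inferInstanceAs (Finite Unit)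
  | case k f ih => exact inferInstanceAs (Finite (Option (Σ o, Label (f o))))
  | seq P Q ihP ihQ => exact inferInstanceAs (Finite (Label P ⊕ Label Q))
  | loop P ih => exact inferInstanceAs (Finite (Bool ⊕ Label P))

/-- The label at which the machine code of a program starts. -/
def entry : (P : StackProg R Γ) → P.Label
  | skip => ()
  | push _ _ => ()
  | pop _ => ()
  | case _ _ => none
  | seq P _ => .inl (entry P)
  | loop _ => .inl false

end StackProg

/-! ### Machine statements -/

/-- The stacks of the machine: input and output (`inl false`, `inl true`), the stacks of the
program, and two counters for each label. -/
abbrev StackIndex (R Λ : Type) : Type := Bool ⊕ (R ⊕ Λ × Bool)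

/-- The alphabets of the stacks. -/
def StackSymbol (I O Γ R Λ : Type) : StackIndex R Λ → Type
  | .inl false => I
  | .inl true => O
  | .inr _ => Γ

variable {I O Γ R Λ : Type}

/-- The family of stacks with input `i`, output `o`, and inner stacks `Z`. -/
def mkStacks (i : List I) (o : List O) (Z : R ⊕ Λ × Bool → List Γ) :
    ∀ k, List (StackSymbol I O Γ R Λ k)
  | .inl false => i
  | .inl true => o
  | .inr k => Z k

section Update

variable [DecidableEq R] [DecidableEq Λ]

theorem update_mkStacks_inp (i i' : List I) (o : List O) (Z : R ⊕ Λ × Bool → List Γ) :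
    update (mkStacks i o Z) (.inl false) i' = mkStacks i' o Z := by
  refine update_eq_iff.2 ⟨rfl, ?_⟩
  rintro ((_ | _) | k) h
  exacts [(h rfl).elim, rfl, rfl]

theorem update_mkStacks_out (i : List I) (o o' : List O) (Z : R ⊕ Λ × Bool → List Γ) :
    update (mkStacks i o Z) (.inl true) o' = mkStacks i o' Z := by
  refine update_eq_iff.2 ⟨rfl, ?_⟩
  rintro ((_ | _) | k) h
  exacts [rfl, (h rfl).elim, rfl]

theorem update_mkStacks_inr (i : List I) (o : List O) (Z : R ⊕ Λ × Bool → List Γ)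
    (k : R ⊕ Λ × Bool) (l : List Γ) :
    update (mkStacks i o Z) (.inr k) l = mkStacks i o (update Z k l) := by
  refine update_eq_iff.2 ⟨(update_self k l Z).symm, ?_⟩
  rintro ((_ | _) | k') h
  exacts [rfl, rfl, (update_of_ne (fun e => h (congrArg _ e)) l Z).symm]

end Update

/-- Statements of the machine. The internal state is meant for the symbol that was read last. -/
abbrev MachineStmt (I O Γ R Λ : Type) : Type := TM2.Stmt (StackSymbol I O Γ R Λ) Λ (Option Γ)

namespace MachineStmt

/-- Push a symbol on an inner stack. -/
def push (k : R ⊕ Λ × Bool) (a : Option Γ → Γ) (q : MachineStmt I O Γ R Λ) :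
    MachineStmt I O Γ R Λ :=
  TM2.Stmt.push (Γ := StackSymbol I O Γ R Λ) (.inr k) a q

/-- Pop a symbol from an inner stack. -/
def pop (k : R ⊕ Λ × Bool) (f : Option Γ → Option Γ → Option Γ) (q : MachineStmt I O Γ R Λ) :
    MachineStmt I O Γ R Λ :=
  TM2.Stmt.pop (Γ := StackSymbol I O Γ R Λ) (.inr k) f q

/-- Read the top symbol of an inner stack. -/
def peek (k : R ⊕ Λ × Bool) (f : Option Γ → Option Γ → Option Γ) (q : MachineStmt I O Γ R Λ) :
    MachineStmt I O Γ R Λ :=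
  TM2.Stmt.peek (Γ := StackSymbol I O Γ R Λ) (.inr k) f q

/-- Pop a symbol from the input stack. -/
def popInp (f : Option Γ → Option I → Option Γ) (q : MachineStmt I O Γ R Λ) :
    MachineStmt I O Γ R Λ :=
  TM2.Stmt.pop (Γ := StackSymbol I O Γ R Λ) (.inl false) f q

/-- Push a symbol on the output stack. -/
def pushOut (a : Option Γ → O) (q : MachineStmt I O Γ R Λ) : MachineStmt I O Γ R Λ :=
  TM2.Stmt.push (Γ := StackSymbol I O Γ R Λ) (.inl true) a q

open Classical in
/-- Push the symbol that was read last on the output stack. If the output alphabet is empty, then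
no symbol can be pushed, and the statement does nothing. -/
noncomputable def output (outSym : Γ → Option O) (q : MachineStmt I O Γ R Λ) :
    MachineStmt I O Γ R Λ :=
  if h : Nonempty O then pushOut (fun v => (v.bind outSym).getD h.some) q else q

/-- Add a token to the counters `(l, false)` of all the labels `l` in a list. -/
def tickAll [Inhabited Γ] (L : List Λ) (q : MachineStmt I O Γ R Λ) : MachineStmt I O Γ R Λ :=
  L.foldr (fun l q => push (.inr (l, false)) (fun _ => default) q) q

/-- Pop a symbol from all the stacks in a list, and keep one of these symbols, if there is one. -/
def popAll (L : List (R ⊕ Λ × Bool)) (q : MachineStmt I O Γ R Λ) : MachineStmt I O Γ R Λ :=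
  L.foldr (fun k q => pop k (fun v o => o.or v) q) q

variable [DecidableEq R] [DecidableEq Λ] (i : List I) (o : List O) (Z : R ⊕ Λ × Bool → List Γ)
  (q : MachineStmt I O Γ R Λ) (v : Option Γ) (k : R ⊕ Λ × Bool)

@[simp]
theorem stepAux_push (a : Option Γ → Γ) :
    TM2.stepAux (push k a q) v (mkStacks i o Z) =
      TM2.stepAux q v (mkStacks i o (update Z k (a v :: Z k))) := by
  rw [← update_mkStacks_inr]
  rfl

@[simp]
theorem stepAux_pop (f : Option Γ → Option Γ → Option Γ) :
    TM2.stepAux (pop k f q) v (mkStacks i o Z) =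
      TM2.stepAux q (f v (Z k).head?) (mkStacks i o (update Z k (Z k).tail)) := by
  rw [← update_mkStacks_inr]
  rfl

@[simp]
theorem stepAux_peek (f : Option Γ → Option Γ → Option Γ) :
    TM2.stepAux (peek k f q) v (mkStacks i o Z) =
      TM2.stepAux q (f v (Z k).head?) (mkStacks i o Z) :=
  rfl

@[simp]
theorem stepAux_popInp (f : Option Γ → Option I → Option Γ) :
    TM2.stepAux (popInp f q) v (mkStacks i o Z) =
      TM2.stepAux q (f v i.head?) (mkStacks i.tail o Z) := by
  rw [← update_mkStacks_inp i i.tail]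
  rfl

@[simp]
theorem stepAux_pushOut (a : Option Γ → O) :
    TM2.stepAux (pushOut a q) v (mkStacks i o Z) =
      TM2.stepAux q v (mkStacks i (a v :: o) Z) := by
  rw [← update_mkStacks_out i o (a v :: o)]
  rfl

theorem stepAux_output {outSym : Γ → Option O} {x : O} {v : Option Γ}
    (h : v.bind outSym = some x) :
    TM2.stepAux (output outSym q) v (mkStacks i o Z) =
      TM2.stepAux q v (mkStacks i (x :: o) Z) := by
  simp [output, dif_pos (Nonempty.intro x), h]

theorem stepAux_tickAll [Inhabited Γ] (S : R → List Γ) {L : List Λ} (hL : L.Nodup)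
    (c : Λ × Bool → List Γ) :
    TM2.stepAux (tickAll L q) v (mkStacks i o (Sum.elim S c)) =
      TM2.stepAux q v (mkStacks i o (Sum.elim S fun x =>
        if x.1 ∈ L ∧ x.2 = false then default :: c x else c x)) := by
  induction L generalizing c with
  | nil => simp [tickAll]
  | cons l L ih =>
    obtain ⟨hl, hL'⟩ := List.nodup_cons.1 hL
    have hcons : tickAll (l :: L) q = push (.inr (l, false)) (fun _ => default) (tickAll L q) := rfl
    rw [hcons, stepAux_push, Sum.elim_inr, Sum.update_elim_inr, ih hL']
    congr 3
    funext ⟨x, b⟩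
    rcases eq_or_ne x l with rfl | hne <;> cases b <;> simp [*]

open Classical in
theorem stepAux_popAll {L : List (R ⊕ Λ × Bool)} (hL : L.Nodup) :
    ∃ v', TM2.stepAux (popAll L q) v (mkStacks i o Z) =
        TM2.stepAux q v' (mkStacks i o fun k => if k ∈ L then (Z k).tail else Z k) ∧
      (v' = none ↔ v = none ∧ ∀ k ∈ L, Z k = []) := by
  induction L generalizing v Z with
  | nil => exact ⟨v, by simp [popAll], by simp⟩
  | cons l L ih =>
    obtain ⟨hl, hL'⟩ := List.nodup_cons.1 hL
    have hne : ∀ k ∈ L, k ≠ l := fun k hk e => hl (e ▸ hk)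
    have hcons : popAll (l :: L) q = pop l (fun v o => o.or v) (popAll L q) := rfl
    obtain ⟨v', hv', hnone⟩ := ih (update Z l (Z l).tail) ((Z l).head?.or v) hL'
    refine ⟨v', ?_, ?_⟩
    · rw [hcons, stepAux_pop, hv']
      congr 2
      funext k
      rcases eq_or_ne k l with rfl | hkl <;> simp [*]
    · have hupd : (∀ k ∈ L, update Z l (Z l).tail k = []) ↔ ∀ k ∈ L, Z k = [] :=
        forall₂_congr fun k hk => by rw [update_of_ne (hne k hk)]
      rw [hnone, Option.or_eq_none_iff, hupd, List.head?_eq_none_iff, List.forall_mem_cons]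
      tauto

end MachineStmt

/-- `f` leads from `a` to `b` in at most `t` steps. -/
def ReachesIn {σ : Type*} (f : σ → Option σ) (t : ℕ) (a b : σ) : Prop :=
  Nonempty (EvalsToInTime f a (some b) t)

namespace ReachesIn

variable {σ : Type*} {f : σ → Option σ} {a b c : σ} {s t : ℕ}

theorem mono (h : ReachesIn f s a b) (hst : s ≤ t) : ReachesIn f t a b :=
  h.elim fun e => ⟨⟨e.toEvalsTo, e.steps_le_m.trans hst⟩⟩

theorem trans (h₁ : ReachesIn f s a b) (h₂ : ReachesIn f t b c) : ReachesIn f (s + t) a c :=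
  h₁.elim fun e₁ => h₂.elim fun e₂ => by
    rw [add_comm]
    exact ⟨EvalsToInTime.trans f s t a b (some c) e₁ e₂⟩

theorem single (h : f a = some b) : ReachesIn f 1 a b :=
  ⟨⟨⟨1, by simpa [flip] using h⟩, le_rfl⟩⟩

theorem head (h : f a = some b) (h₂ : ReachesIn f t b c) : ReachesIn f (t + 1) a c := by
  rw [add_comm]
  exact (single h).trans h₂

end ReachesIn

/-- The machine with code `M` gets from the label `l` and the stacks `Z` to the label `l'` and the
stacks `Z'` in at most `t` steps, whatever its internal state is at the start. -/
def Leads [DecidableEq R] [DecidableEq Λ] (M : Λ → MachineStmt I O Γ R Λ) (t : ℕ) (l : Λ)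
    (Z : ∀ k, List (StackSymbol I O Γ R Λ k)) (l' : Λ)
    (Z' : ∀ k, List (StackSymbol I O Γ R Λ k)) : Prop :=
  ∀ v, ∃ v', ReachesIn (TM2.step M) t ⟨some l, v, Z⟩ ⟨some l', v', Z'⟩

namespace Leads

variable [DecidableEq R] [DecidableEq Λ] {M : Λ → MachineStmt I O Γ R Λ} {s t : ℕ} {l l' l'' : Λ}
  {Z Z' Z'' : ∀ k, List (StackSymbol I O Γ R Λ k)}

theorem refl (l : Λ) (Z : ∀ k, List (StackSymbol I O Γ R Λ k)) : Leads M 0 l Z l Z :=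
  fun v => ⟨v, ⟨EvalsToInTime.refl _ _⟩⟩

theorem mono (h : Leads M s l Z l' Z') (hst : s ≤ t) : Leads M t l Z l' Z' := fun v =>
  (h v).imp fun _ hv => hv.mono hst

theorem trans (h₁ : Leads M s l Z l' Z') (h₂ : Leads M t l' Z' l'' Z'') :
    Leads M (s + t) l Z l'' Z'' := fun v =>
  let ⟨v₁, hv₁⟩ := h₁ v
  (h₂ v₁).imp fun _ hv₂ => hv₁.trans hv₂

theorem single (h : ∀ v, ∃ v', TM2.stepAux (M l) v Z = ⟨some l', v', Z'⟩) :
    Leads M 1 l Z l' Z' := fun v =>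
  (h v).imp fun _ hv => .single (congrArg some hv)

theorem head (h : ∀ v, ∃ v', TM2.stepAux (M l) v Z = ⟨some l', v', Z'⟩)
    (h₂ : Leads M t l' Z' l'' Z'') : Leads M (t + 1) l Z l'' Z'' := by
  rw [add_comm]
  exact (single h).trans h₂

end Leads

/-! ### Machine code for stack programs -/

section LoopCounters

variable [Inhabited Γ]

/-- The statement that moves a token from the counter `(z, d)` to the counter `(z, !d)` and goes to
`x`, or goes to `y` if there is no token left. -/
def moveToken (z : Λ) (d : Bool) (x y : Λ) : MachineStmt I O Γ R Λ :=
  MachineStmt.pop (.inr (z, d)) (fun _ o => o) <|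
    .branch Option.isSome
      (MachineStmt.push (.inr (z, !d)) (fun _ => default) (.goto fun _ => x))
      (.goto fun _ => y)

variable [DecidableEq Λ]

/-- The counters `c`, except that the loop at `z` has `a` remaining and `b` completed
iterations. -/
def loopCounters (c : Λ × Bool → List Γ) (z : Λ) (a b : ℕ) : Λ × Bool → List Γ :=
  update (update c (z, false) (List.replicate a default)) (z, true) (List.replicate b default)

variable {c : Λ × Bool → List Γ} {z : Λ} {a b : ℕ}

theorem loopCounters_false : loopCounters c z a b (z, false) = List.replicate a default := by
  simp [loopCounters]

theorem loopCounters_true : loopCounters c z a b (z, true) = List.replicate b default := by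
  simp [loopCounters]

theorem loopCounters_of_ne {x : Λ × Bool} (h : x.1 ≠ z) : loopCounters c z a b x = c x := by
  rw [loopCounters, update_of_ne fun e => h (congrArg Prod.fst e),
    update_of_ne fun e => h (congrArg Prod.fst e)]

theorem loopCounters_eq_self (h₁ : c (z, false) = List.replicate a default)
    (h₂ : c (z, true) = List.replicate b default) : loopCounters c z a b = c := by
  rw [loopCounters, ← h₁, ← h₂, update_eq_self, update_eq_self]

theorem update_loopCounters_false (a' : ℕ) :
    update (loopCounters c z a b) (z, false) (List.replicate a' default) =
      loopCounters c z a' b := by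
  rw [loopCounters, update_comm (by simp), update_idem, loopCounters]

theorem update_loopCounters_true (b' : ℕ) :
    update (loopCounters c z a b) (z, true) (List.replicate b' default) =
      loopCounters c z a b' := by
  rw [loopCounters, update_idem, loopCounters]

variable [DecidableEq R] {M : Λ → MachineStmt I O Γ R Λ} {l x y : Λ} {i : List I} {o : List O}
  {S : R → List Γ}

theorem Leads.moveToken_false_succ {t : ℕ} {l' : Λ}
    {Z : ∀ k, List (StackSymbol I O Γ R Λ k)} (hM : M l = moveToken z false x y)
    (h : Leads M t x (mkStacks i o (Sum.elim S (loopCounters c z a (b + 1)))) l' Z) :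
    Leads M (t + 1) l (mkStacks i o (Sum.elim S (loopCounters c z (a + 1) b))) l' Z := by
  refine .head (fun v => ⟨some default, ?_⟩) h
  have hpop := update_loopCounters_false (c := c) (z := z) (a := a + 1) (b := b) a
  have hpush := update_loopCounters_true (c := c) (z := z) (a := a) (b := b) (b + 1)
  simp only [List.replicate_succ] at hpush
  simp [hM, moveToken, hpop, hpush, loopCounters_false, loopCounters_true, List.replicate_succ,
    -Sum.elim_update_left, -Sum.elim_update_right]

theorem Leads.moveToken_true_succ {t : ℕ} {l' : Λ}
    {Z : ∀ k, List (StackSymbol I O Γ R Λ k)} (hM : M l = moveToken z true x y)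
    (h : Leads M t x (mkStacks i o (Sum.elim S (loopCounters c z (a + 1) b))) l' Z) :
    Leads M (t + 1) l (mkStacks i o (Sum.elim S (loopCounters c z a (b + 1)))) l' Z := by
  refine .head (fun v => ⟨some default, ?_⟩) h
  have hpop := update_loopCounters_true (c := c) (z := z) (a := a) (b := b + 1) b
  have hpush := update_loopCounters_false (c := c) (z := z) (a := a) (b := b) (a + 1)
  simp only [List.replicate_succ] at hpush
  simp [hM, moveToken, hpop, hpush, loopCounters_false, loopCounters_true, List.replicate_succ,
    -Sum.elim_update_left, -Sum.elim_update_right]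

theorem Leads.moveToken_false_zero (hM : M l = moveToken z false x y) :
    Leads M 1 l (mkStacks i o (Sum.elim S (loopCounters c z 0 b))) y
      (mkStacks i o (Sum.elim S (loopCounters c z 0 b))) := by
  refine .single fun v => ⟨none, ?_⟩
  have hpop := update_loopCounters_false (c := c) (z := z) (a := 0) (b := b) 0
  rw [List.replicate_zero] at hpop
  simp [hM, moveToken, loopCounters_false, hpop, -Sum.elim_update_left, -Sum.elim_update_right]

theorem Leads.moveToken_true_zero (hM : M l = moveToken z true x y) :
    Leads M 1 l (mkStacks i o (Sum.elim S (loopCounters c z a 0))) y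
      (mkStacks i o (Sum.elim S (loopCounters c z a 0))) := by
  refine .single fun v => ⟨none, ?_⟩
  have hpop := update_loopCounters_true (c := c) (z := z) (a := a) (b := 0) 0
  rw [List.replicate_zero] at hpop
  simp [hM, moveToken, loopCounters_true, hpop, -Sum.elim_update_left, -Sum.elim_update_right]

theorem Leads.loop_iterate {F : (R → List Γ) → R → List Γ} {t : ℕ}
    (hM : M z = moveToken z false x y)
    (hF : ∀ S a b, Leads M t x (mkStacks i o (Sum.elim S (loopCounters c z a b))) z
      (mkStacks i o (Sum.elim (F S) (loopCounters c z a b)))) (a b : ℕ) (S : R → List Γ) :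
    Leads M (a * (t + 1)) z (mkStacks i o (Sum.elim S (loopCounters c z a b))) z
      (mkStacks i o (Sum.elim (F^[a] S) (loopCounters c z 0 (b + a)))) := by
  induction a generalizing b S with
  | zero => simpa using Leads.refl z _
  | succ a ih =>
    have h := ((hF S a (b + 1)).moveToken_false_succ hM).trans (ih (b + 1) (F S))
    rw [iterate_succ_apply, ← add_assoc, add_right_comm]
    exact h.mono (by rw [Nat.succ_mul, add_comm])

theorem Leads.loop_restore (hM : M x = moveToken z true x y) (a b : ℕ) (S : R → List Γ) :
    Leads M (b + 1) x (mkStacks i o (Sum.elim S (loopCounters c z a b))) y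
      (mkStacks i o (Sum.elim S (loopCounters c z (a + b) 0))) := by
  induction b generalizing a with
  | zero => exact moveToken_true_zero hM
  | succ b ih =>
    have h := ih (a + 1)
    rw [add_right_comm a] at h
    exact h.moveToken_true_succ hM

end LoopCounters

namespace StackProg

/-- The machine code of a program inside a machine with labels `Λ`: the labels of the program are
embedded by `emb`, and control passes to `exit` at the end. The stacks `(l, false)` and `(l, true)`
hold the remaining and the completed iterations of the loop with label `l`. -/
def code [Inhabited Γ] (I O : Type) :
    (P : StackProg R Γ) → (P.Label → Λ) → Λ → P.Label → MachineStmt I O Γ R Λ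
  | skip, _, exit, _ => .goto fun _ => exit
  | push k a, _, exit, _ => MachineStmt.push (.inl k) (fun _ => a) (.goto fun _ => exit)
  | pop k, _, exit, _ => MachineStmt.pop (.inl k) (fun v _ => v) (.goto fun _ => exit)
  | case k f, emb, _, none =>
    MachineStmt.peek (.inl k) (fun _ o => o) (.goto fun v => emb (some ⟨v, entry (f v)⟩))
  | case _ f, emb, exit, some ⟨o, l⟩ => code I O (f o) (fun l => emb (some ⟨o, l⟩)) exit l
  | seq P Q, emb, _, .inl l => code I O P (fun l => emb (.inl l)) (emb (.inr (entry Q))) l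
  | seq _ Q, emb, exit, .inr l => code I O Q (fun l => emb (.inr l)) exit l
  | loop P, emb, _, .inl false =>
    moveToken (emb (.inl false)) false (emb (.inr (entry P))) (emb (.inl true))
  | loop _, emb, exit, .inl true =>
    moveToken (emb (.inl false)) true (emb (.inl true)) exit
  | loop P, emb, _, .inr l => code I O P (fun l => emb (.inr l)) (emb (.inl false)) l

section Code

variable [Inhabited Γ]

/-- The code `M` of a machine contains the code of the program `P`. -/
structure Hosts (M : Λ → MachineStmt I O Γ R Λ) (P : StackProg R Γ) (emb : P.Label → Λ)
    (exit : Λ) : Prop where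
  injective : Injective emb
  eq_code : ∀ l, M (emb l) = P.code I O emb exit l

/-- At the labels `emb`, the loop counters `c` are ready for loops with `n` iterations. -/
def CountersReady {ι : Type} (n : ℕ) (emb : ι → Λ) (c : Λ × Bool → List Γ) : Prop :=
  ∀ l, c (emb l, false) = List.replicate n default ∧ c (emb l, true) = []

variable [Fintype Γ] [DecidableEq R] [DecidableEq Λ]

/-- The machine code `M` runs the program `P` correctly and in time, wherever it contains `P`. -/
def RunsOn (n : ℕ) (M : Λ → MachineStmt I O Γ R Λ) (P : StackProg R Γ) : Prop :=
  ∀ ⦃emb : P.Label → Λ⦄ ⦃exit : Λ⦄, Hosts M P emb exit →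
    ∀ ⦃c⦄, CountersReady n emb c → ∀ i o S,
      Leads M (P.cost.eval n) (emb P.entry) (mkStacks i o (Sum.elim S c)) exit
        (mkStacks i o (Sum.elim (P.run n S) c))

variable {n : ℕ} {M : Λ → MachineStmt I O Γ R Λ}

theorem RunsOn.case {k : R} {f : Option Γ → StackProg R Γ} (hf : ∀ o, (f o).RunsOn n M) :
    (case k f).RunsOn n M := by
  intro emb exit hM c hc i o S
  have hbranch := hf (S k).head? (emb := fun l => emb (some ⟨_, l⟩)) (exit := exit)
    ⟨fun a b hab => by cases hM.injective hab; rfl, fun l => hM.eq_code (some ⟨_, l⟩)⟩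
    (fun l => hc (some ⟨_, l⟩)) i o S
  have hentry : M (emb (StackProg.case k f).entry) = _ := hM.eq_code none
  exact (hbranch.head fun v => ⟨(S k).head?, by simp [hentry, code]⟩).mono
    (eval_cost_le_eval_cost_case n k f _)

theorem RunsOn.seq {P Q : StackProg R Γ} (hP : P.RunsOn n M) (hQ : Q.RunsOn n M) :
    (seq P Q).RunsOn n M := by
  intro emb exit hM c hc i o S
  rw [cost, Polynomial.eval_add]
  exact (hP ⟨fun a b hab => Sum.inl_injective (hM.injective hab), fun l => hM.eq_code (.inl l)⟩
    (fun l => hc (.inl l)) i o S).trans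
    (hQ ⟨fun a b hab => Sum.inr_injective (hM.injective hab), fun l => hM.eq_code (.inr l)⟩
      (fun l => hc (.inr l)) i o (P.run n S))

theorem RunsOn.loop {P : StackProg R Γ} (hP : P.RunsOn n M) : (loop P).RunsOn n M := by
  intro emb exit hM c hc i o S
  have hbody (S : R → List Γ) (a b : ℕ) := hP
    ⟨fun a b hab => Sum.inr_injective (hM.injective hab), fun l => hM.eq_code (.inr l)⟩
    (c := loopCounters c (emb (.inl false)) a b)
    (fun l => by
      have hne : emb (.inr l) ≠ emb (.inl false) := fun e => by cases hM.injective e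
      simpa only [loopCounters_of_ne (x := (_, _)) hne] using hc (.inr l)) i o S
  have hiter := Leads.loop_iterate (hM.eq_code (.inl false)) hbody n 0 S
  have hleave := Leads.moveToken_false_zero (c := c) (b := 0 + n) (i := i) (o := o)
    (S := (P.run n)^[n] S) (hM.eq_code (.inl false))
  have hrestore := Leads.loop_restore (c := c) (i := i) (o := o) (hM.eq_code (.inl true)) 0
    (0 + n) ((P.run n)^[n] S)
  have hcount : loopCounters c (emb (.inl false)) n 0 = c :=
    loopCounters_eq_self (hc (.inl false)).1 (hc (.inl false)).2
  simp only [zero_add, hcount] at hiter hleave hrestore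
  simpa [cost, run, entry] using (hiter.trans hleave).trans hrestore

theorem runsOn (n : ℕ) (M : Λ → MachineStmt I O Γ R Λ) (P : StackProg R Γ) : P.RunsOn n M := by
  induction P with
  | skip | push | pop =>
    intro emb exit hM c _ i o S
    rw [cost, Polynomial.eval_one]
    exact .single fun v => ⟨v, by
      simp [hM.eq_code, code, run, -Sum.elim_update_left, -Sum.elim_update_right]⟩
  | case k f ih => exact .case ih
  | seq P Q ihP ihQ => exact ihP.seq ihQ
  | loop P ih => exact ih.loop

end Code

end StackProg

/-! ### The machine that runs a stack program -/

section UniversalStatements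

variable [DecidableEq R] [Fintype Λ] [DecidableEq Λ] (i : List I) (o : List O)
  (q : MachineStmt I O Γ R Λ) (v : Option Γ)

theorem stepAux_popAll_univ [Fintype R] (Z : R ⊕ Λ × Bool → List Γ) :
    ∃ v', TM2.stepAux (MachineStmt.popAll Finset.univ.toList q) v (mkStacks i o Z) =
        TM2.stepAux q v' (mkStacks i o fun k => (Z k).tail) ∧
      (v' = none ↔ v = none ∧ ∀ k, Z k = []) := by
  simpa using MachineStmt.stepAux_popAll i o Z q v (Finset.nodup_toList Finset.univ)

variable [Inhabited Γ]

/-- The counters of all the loops with `m` remaining iterations and no completed ones. -/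
def uniformCounters (Γ Λ : Type) [Inhabited Γ] (m : ℕ) : Λ × Bool → List Γ :=
  fun x => if x.2 = false then List.replicate m default else []

theorem stepAux_tickAll_univ (S : R → List Γ) (m : ℕ) :
    TM2.stepAux (MachineStmt.tickAll Finset.univ.toList q) v
        (mkStacks i o (Sum.elim S (uniformCounters Γ Λ m))) =
      TM2.stepAux q v (mkStacks i o (Sum.elim S (uniformCounters Γ Λ (m + 1)))) := by
  rw [MachineStmt.stepAux_tickAll i o q v S (Finset.nodup_toList _)]
  congr 3
  funext ⟨x, d⟩
  cases d <;> simp [uniformCounters, List.replicate_succ]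

end UniversalStatements

section Machine

variable [Fintype Γ] [Inhabited Γ] [Fintype R] [DecidableEq R]

noncomputable instance (P : StackProg R Γ) : Fintype P.Label :=
  have := P.finite_label
  Fintype.ofFinite _

noncomputable instance (P : StackProg R Γ) : DecidableEq P.Label := Classical.decEq _

/-- The labels of the machine: loading the input (`0`), unloading the output (`1`), emptying the
stacks (`2`), and the labels of the program. -/
abbrev MachineLabel (P : StackProg R Γ) : Type := Fin 3 ⊕ P.Label

/-- The code of the machine that moves the input to the stack `rin`, runs a program, moves the
stack `rout` to the output, and empties all the other stacks. For every input symbol, and once more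
at the end of the input, all the loop counters get a token. -/
noncomputable def machineCode (inSym : I → Γ) (outSym : Γ → Option O) (P : StackProg R Γ)
    (rin rout : R) : MachineLabel P → MachineStmt I O Γ R (MachineLabel P)
  | .inl 0 => MachineStmt.popInp (fun _ o => o.map inSym) <|
      MachineStmt.tickAll Finset.univ.toList <|
      .branch Option.isSome
        (MachineStmt.push (.inl rin) (fun v => v.getD default) (.goto fun _ => .inl 0))
        (.goto fun _ => .inr P.entry)
  | .inl 1 => MachineStmt.pop (.inl rout) (fun _ o => o) <|
      .branch Option.isSome
        (MachineStmt.output outSym (.goto fun _ => .inl 1))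
        (.goto fun _ => .inl 2)
  | .inl 2 => .load (fun _ => none) <| MachineStmt.popAll Finset.univ.toList <|
      .branch Option.isSome (.goto fun _ => .inl 2) .halt
  | .inr l => P.code I O Sum.inr (.inl 1) l

variable (inSym : I → Γ) (outSym : Γ → Option O) (P : StackProg R Γ) (rin rout : R)

theorem machineCode_load (i : List I) (S : R → List Γ) (m : ℕ) :
    Leads (machineCode inSym outSym P rin rout) (i.length + 1)
      (.inl 0) (mkStacks i [] (Sum.elim S (uniformCounters _ _ m)))
      (.inr P.entry) (mkStacks [] [] (Sum.elim
        (update S rin (i.reverse.map inSym ++ S rin))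
          (uniformCounters _ _ (m + i.length + 1)))) := by
  induction i generalizing S m with
  | nil =>
    refine .single fun v => ⟨none, ?_⟩
    rw [machineCode, MachineStmt.stepAux_popInp, stepAux_tickAll_univ]
    simp [-Sum.elim_update_left]
  | cons x i ih =>
    have h := ih (update S rin (inSym x :: S rin)) (m + 1)
    have hcount : m + 1 + i.length + 1 = m + (x :: i).length + 1 := by
      rw [List.length_cons]
      lia
    have hstack : update (update S rin (inSym x :: S rin)) rin
        (i.reverse.map inSym ++ update S rin (inSym x :: S rin) rin) =
        update S rin ((x :: i).reverse.map inSym ++ S rin) := by simp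
    rw [hcount, hstack] at h
    refine h.head fun v => ⟨some (inSym x), ?_⟩
    rw [machineCode, MachineStmt.stepAux_popInp, stepAux_tickAll_univ]
    simp [-Sum.elim_update_left, -Sum.elim_update_right]

theorem machineCode_unload {outSym : Γ → Option O} {osym : O → Γ}
    (hosym : ∀ x, outSym (osym x) = some x) (w o : List O) (S : R → List Γ)
    (c : MachineLabel P × Bool → List Γ) (hS : S rout = w.map osym) :
    Leads (machineCode inSym outSym P rin rout) (w.length + 1)
      (.inl 1) (mkStacks [] o (Sum.elim S c))
      (.inl 2) (mkStacks [] (w.reverse ++ o) (Sum.elim (update S rout []) c)) := by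
  induction w generalizing o S with
  | nil =>
    refine .single fun v => ⟨none, ?_⟩
    simp [machineCode, hS, -Sum.elim_update_left, -Sum.elim_update_right]
  | cons x w ih =>
    have h := ih (x :: o) (update S rout (w.map osym)) (by simp)
    rw [update_idem] at h
    rw [List.reverse_cons, List.append_assoc, List.singleton_append]
    refine h.head fun v => ⟨some (osym x), ?_⟩
    have hout : (some (osym x)).bind outSym = some x := hosym x
    simp [machineCode, hS, MachineStmt.stepAux_output _ _ _ _ hout, -Sum.elim_update_left,
      -Sum.elim_update_right]

theorem machineCode_clean (o : List O) (m : ℕ) (Z : R ⊕ MachineLabel P × Bool → List Γ)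
    (hZ : ∀ k, (Z k).length ≤ m) (v : Option Γ) :
    ReachesIn (TM2.step (machineCode inSym outSym P rin rout)) (m + 1)
      ⟨some (.inl 2), v, mkStacks [] o Z⟩ ⟨none, none, mkStacks [] o fun _ => []⟩ := by
  induction m generalizing Z v with
  | zero =>
    have hempty : ∀ k, Z k = [] := fun k => List.length_eq_zero_iff.1 (Nat.le_zero.1 (hZ k))
    obtain ⟨v', hstep, hnone⟩ := stepAux_popAll_univ ([] : List I) o
      (.branch Option.isSome (.goto fun _ => .inl 2) .halt) none Z
    obtain rfl : v' = none := hnone.2 ⟨rfl, hempty⟩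
    exact .single (by simp [machineCode, TM2.stepAux, hstep, hempty])
  | succ m ih =>
    obtain ⟨v', hstep, hnone⟩ := stepAux_popAll_univ ([] : List I) o
      (.branch Option.isSome (.goto fun _ => .inl 2) .halt) none Z
    cases v' with
    | none =>
      have hempty := (hnone.1 rfl).2
      exact (ih Z (by simp [hempty]) v).mono (Nat.le_succ _)
    | some a =>
      have hnext := ih (fun k => (Z k).tail)
        (fun k => by rw [List.length_tail]; exact Nat.sub_le_of_le_add (hZ k)) (some a)
      exact hnext.head (by simp [machineCode, TM2.stepAux, hstep])

/-- The bundled machine that runs a program. -/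
noncomputable def machine [Fintype I] : FinTM2 where
  K := StackIndex R (MachineLabel P)
  k₀ := .inl false
  k₁ := .inl true
  Γ := StackSymbol I O Γ R (MachineLabel P)
  Λ := MachineLabel P
  main := .inl 0
  σ := Option Γ
  initialState := none
  Γk₀Fin := inferInstanceAs (Fintype I)
  m := machineCode inSym outSym P rin rout

theorem initList_machine [Fintype I] (i : List I) :
    initList (machine inSym outSym P rin rout) i =
      ⟨some (.inl 0), none, mkStacks i [] fun _ => []⟩ := by
  unfold initList
  congr 1
  funext k
  rcases k with (_ | _) | k <;> rfl

theorem haltList_machine [Fintype I] (o : List O) :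
    haltList (machine inSym outSym P rin rout) o = ⟨none, none, mkStacks [] o fun _ => []⟩ := by
  unfold haltList
  congr 1
  funext k
  rcases k with (_ | _) | k <;> rfl

/-- The number of steps of the machine that runs the program `P`, as a polynomial in the length of
the input. -/
noncomputable def StackProg.time (P : StackProg R Γ) : Polynomial ℕ :=
  (Polynomial.X + 1) + P.cost.comp (Polynomial.X + 1) + (P.cost.comp (Polynomial.X + 1) + 1) +
    (Polynomial.X + P.cost.comp (Polynomial.X + 1) + 2)

variable {inSym outSym P rin rout}

theorem machineCode_reachesIn {osym : O → Γ} (hosym : ∀ x, outSym (osym x) = some x)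
    (hio : rin ≠ rout) (i : List I) (o : List O)
    (hP : P.run (i.length + 1) (update (fun _ => []) rin (i.reverse.map inSym)) rout =
      o.reverse.map osym) :
    ReachesIn (TM2.step (machineCode inSym outSym P rin rout)) (P.time.eval i.length)
      ⟨some (.inl 0), none, mkStacks i [] fun _ => []⟩ ⟨none, none, mkStacks [] o fun _ => []⟩ := by
  set n := i.length + 1 with hn
  set S := update (fun _ => []) rin (i.reverse.map inSym) with hS
  have hSlen : ∀ k, (S k).length ≤ n := fun k => by
    rcases eq_or_ne k rin with rfl | hk <;> simp [*]
  have hrun := P.length_run_le n S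
  have hload := machineCode_load inSym outSym P rin rout i (fun _ => []) 0
  have hcomp := P.runsOn n (machineCode inSym outSym P rin rout)
    ⟨Sum.inr_injective, fun _ => rfl⟩ (c := uniformCounters _ _ n) (exit := .inl 1)
    (fun l => by simp [uniformCounters]) [] [] S
  have hunload := machineCode_unload inSym P rin rout hosym o.reverse [] (P.run n S)
    (uniformCounters _ _ n) hP
  have hclean := machineCode_clean inSym outSym P rin rout o (n + P.cost.eval n)
    (Sum.elim (update (P.run n S) rout []) (uniformCounters _ _ n)) fun k => by
      rcases k with k | ⟨l, d⟩
      · rcases eq_or_ne k rout with rfl | hk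
        · simp
        · simpa [hk] using (hrun k).trans (Nat.add_le_add_right (hSlen k) _)
      · cases d <;> simp [uniformCounters]
  have hstart : Sum.elim (fun _ : R => ([] : List Γ)) (uniformCounters Γ (MachineLabel P) 0) =
      fun _ => [] := by
    funext k
    rcases k with _ | ⟨l, d⟩ <;> simp [uniformCounters]
  have hout : o.length ≤ P.cost.eval n := by
    have := hP ▸ hrun rout
    simpa [hS, hio.symm] using this
  simp only [hstart, List.append_nil, zero_add, List.reverse_reverse] at hload hunload
  obtain ⟨v, hv⟩ := (hload.trans hcomp).trans hunload none
  refine (hv.trans (hclean v)).mono ?_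
  simp only [StackProg.time, Polynomial.eval_add, Polynomial.eval_comp, Polynomial.eval_X,
    Polynomial.eval_one, Polynomial.eval_ofNat, List.length_reverse, ← hn]
  lia

omit [Fintype Γ] [Fintype R] in
theorem StackProg.computableInPolyTime [Finite Γ] [Finite R] [Finite I] {α : Type}
    (ea : α → List I) (f : α → List O) {osym : O → Γ} (hosym : Injective osym) (hio : rin ≠ rout)
    (hP : ∀ a, P.run ((ea a).length + 1) (update (fun _ => []) rin ((ea a).reverse.map inSym))
      rout = (f a).reverse.map osym) :
    Nonempty (TM2ComputableInPolyTime ea (fun w : List O => w) f) := by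
  cases nonempty_fintype Γ
  cases nonempty_fintype R
  cases nonempty_fintype I
  refine ⟨⟨⟨machine inSym (partialInv osym) P rin rout, Equiv.refl _, Equiv.refl _⟩, P.time,
    fun a => Nonempty.some ?_⟩⟩
  have h := machineCode_reachesIn (partialInv_left hosym) hio (ea a) (f a) (hP a)
  unfold TM2OutputsInTime
  have hin : (ea a).map (Equiv.refl _).invFun = ea a := List.map_id _
  have hout : (f a).map (Equiv.refl _).invFun = f a := List.map_id _
  erw [hin, hout, initList_machine, Option.map_some, haltList_machine]
  exact h

end Machine

end ClosestElement

namespace ClosestElement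

open Turing Function

/-! ### Programs on arrays -/

/-- The contents of a family of infinite arrays over `Γ`, indexed by `Ar`, together with the output
that has been produced so far, last symbol first. -/
structure Store (Ar Γ : Type) where
  /-- the contents of the arrays -/
  arr : Ar → ℕ → Γ
  /-- the output, last symbol first -/
  out : List Γ

/-- A position in an array, as a sum of terms `(t, w)`. Such a term stands for `n ^ w` times the
value of `t`, where `n` is the number of iterations of all loops, `none` has the value one, and
`some v` has the value of the index variable `v`. -/
abbrev Position (V : Type) : Type := List (Option V × ℕ)

/-- The value of a position. The index variables are cut off at `n`, which is what a loop of `n`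
iterations can count; the indices of loops never exceed this bound. -/
def Position.offset {V : Type} (n : ℕ) (env : V → ℕ) (e : Position V) : ℕ :=
  (e.map fun t => n ^ t.2 * t.1.elim 1 fun v => min (env v) n).sum

@[simp]
theorem Position.offset_nil {V : Type} (n : ℕ) (env : V → ℕ) : Position.offset n env [] = 0 := rfl

theorem Position.offset_none_cons {V : Type} (n : ℕ) (env : V → ℕ) (w : ℕ) (e : Position V) :
    Position.offset n env ((none, w) :: e) = n ^ w + Position.offset n env e := by
  simp [Position.offset]

theorem Position.offset_some_cons {V : Type} (n : ℕ) (env : V → ℕ) (v : V) (w : ℕ)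
    (e : Position V) : Position.offset n env ((some v, w) :: e) =
      n ^ w * min (env v) n + Position.offset n env e := by
  simp [Position.offset]

/-- Programs on arrays over `Γ` that are indexed by `Ar`, with index variables in `V`. All loops
have the same number of iterations, a parameter of the execution. -/
inductive ArrayProg (V Ar Γ : Type) : Type
  | skip : ArrayProg V Ar Γ
  | seq : ArrayProg V Ar Γ → ArrayProg V Ar Γ → ArrayProg V Ar Γ
  | set : Ar → Position V → Γ → ArrayProg V Ar Γ
  | case : Ar → Position V → (Γ → ArrayProg V Ar Γ) → ArrayProg V Ar Γ
  | loop : V → ArrayProg V Ar Γ → ArrayProg V Ar Γ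
  | emit : Γ → ArrayProg V Ar Γ

variable {V Ar Γ : Type}

namespace Store

/-- The store in which the entry number `i` of the array `a` is changed to `x`. -/
def put [DecidableEq Ar] (s : Store Ar Γ) (a : Ar) (i : ℕ) (x : Γ) : Store Ar Γ where
  arr := update s.arr a (update (s.arr a) i x)
  out := s.out

@[simp]
theorem put_arr [DecidableEq Ar] (s : Store Ar Γ) (a : Ar) (i : ℕ) (x : Γ) :
    (s.put a i x).arr = update s.arr a (update (s.arr a) i x) := rfl

@[simp]
theorem put_out [DecidableEq Ar] (s : Store Ar Γ) (a : Ar) (i : ℕ) (x : Γ) :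
    (s.put a i x).out = s.out := rfl

/-- The initial store: the array `a` holds the input `x`, the other arrays are blank. -/
def init [Inhabited Γ] [DecidableEq Ar] (a : Ar) (x : List Γ) : Store Ar Γ where
  arr := update (fun _ _ => default) a fun i => x.getD i default
  out := []

end Store

/-- The effect of a program on arrays, where each loop is repeated `n` times. The index of a loop
counts up from the value of its variable outside of the loop. -/
def ArrayProg.exec [DecidableEq V] [DecidableEq Ar] (n : ℕ) :
    ArrayProg V Ar Γ → (V → ℕ) → Store Ar Γ → Store Ar Γ
  | skip, _, s => s
  | seq P Q, env, s => exec n Q env (exec n P env s)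
  | set a e x, env, s => s.put a (e.offset n env) x
  | case a e f, env, s => exec n (f (s.arr a (e.offset n env))) env s
  | loop v P, env, s =>
    (List.range n).foldl (fun s i => exec n P (update env v (env v + i)) s) s
  | emit x, _, s => { s with out := x :: s.out }

/-! ### Translation of array programs to stack programs -/

/-- The stacks that simulate a program on arrays: each index variable is kept in unary on two
stacks, for its current value and for the part that a count-down has consumed; each array is cut
into a part on the left of a head, in reverse order, and a part on the right of it. -/
inductive DataStack (V Ar : Type) : Type
  | counter : V → DataStack V Ar
  | spent : V → DataStack V Ar
  | left : Ar → DataStack V Ar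
  | right : Ar → DataStack V Ar
  | out : DataStack V Ar
  deriving DecidableEq, Fintype

/-- The stacks `S` hold the store `s` with the head of the array `a` at `pos a`, and the index
variables, with current values `env` and consumed parts `aux`. -/
structure Represents [Inhabited Γ] (env aux : V → ℕ) (s : Store Ar Γ) (pos : Ar → ℕ)
    (S : DataStack V Ar → List Γ) : Prop where
  counter : ∀ v, S (.counter v) = List.replicate (env v) default
  spent : ∀ v, S (.spent v) = List.replicate (aux v) default
  length_left : ∀ a, (S (.left a)).length = pos a
  arr : ∀ a i, ((S (.left a)).reverse ++ S (.right a)).getD i default = s.arr a i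
  out : S .out = s.out

namespace StackProg

variable [Inhabited Γ]

/-- Move the head of an array one step to the right. -/
def moveRight (a : Ar) : StackProg (DataStack V Ar) Γ :=
  case (.right a) fun
    | none => push (.left a) default
    | some x => seq (pop (.right a)) (push (.left a) x)

/-- Move the head of an array one step to the left, if possible. -/
def moveLeft (a : Ar) : StackProg (DataStack V Ar) Γ :=
  case (.left a) fun
    | none => skip
    | some x => seq (pop (.left a)) (push (.right a) x)

/-- Loops of depth `w` around `P`. -/
def nestedLoops (P : StackProg (DataStack V Ar) Γ) : ℕ → StackProg (DataStack V Ar) Γ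
  | 0 => P
  | w + 1 => loop (nestedLoops P w)

/-- If the variable `v` is positive then consume one unit of it and run `P`. -/
def countDown (v : V) (P : StackProg (DataStack V Ar) Γ) : StackProg (DataStack V Ar) Γ :=
  case (.counter v) fun
    | none => skip
    | some _ => seq (pop (.counter v)) (seq (push (.spent v) default) P)

/-- Restore one consumed unit of a variable. -/
def countUp (v : V) : StackProg (DataStack V Ar) Γ :=
  case (.spent v) fun
    | none => skip
    | some _ => seq (pop (.spent v)) (push (.counter v) default)

/-- Repeat `P` as often as the value of a position says. -/
def walk (P : StackProg (DataStack V Ar) Γ) : Position V → StackProg (DataStack V Ar) Γ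
  | [] => skip
  | (none, w) :: e => seq (nestedLoops P w) (walk P e)
  | (some v, w) :: e =>
    seq (seq (loop (countDown v (nestedLoops P w))) (loop (countUp v))) (walk P e)

end StackProg

/-- The translation of programs on arrays to programs on stacks. -/
def ArrayProg.compile [Inhabited Γ] : ArrayProg V Ar Γ → StackProg (DataStack V Ar) Γ
  | skip => .skip
  | seq P Q => .seq P.compile Q.compile
  | set a e x => .seq ((StackProg.moveRight a).walk e) <| .seq (.pop (.right a)) <|
      .seq (.push (.right a) x) ((StackProg.moveLeft a).walk e)
  | case a e f => .seq ((StackProg.moveRight a).walk e) <| .case (.right a) fun o =>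
      .seq ((StackProg.moveLeft a).walk e) (f (o.getD default)).compile
  | loop v P => .seq (.loop (.seq P.compile (.push (.counter v) default)))
      (.loop (.pop (.counter v)))
  | emit x => .push .out x

section Compile

variable [Inhabited Γ] [DecidableEq V] [DecidableEq Ar] {n : ℕ} {env aux : V → ℕ}
  {s : Store Ar Γ} {pos : Ar → ℕ} {S : DataStack V Ar → List Γ}

namespace Represents

theorem setCounter (h : Represents env aux s pos S) (v : V) (k : ℕ) :
    Represents (update env v k) aux s pos
      (update S (.counter v) (List.replicate k default)) where
  counter u := by rcases eq_or_ne u v with rfl | hu <;> simp [*, h.counter]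
  spent u := by simp [h.spent]
  length_left a := by simp [h.length_left]
  arr a i := by simp [← h.arr]
  out := by simp [h.out]

theorem setSpent (h : Represents env aux s pos S) (v : V) (k : ℕ) :
    Represents env (update aux v k) s pos (update S (.spent v) (List.replicate k default)) where
  counter u := by simp [h.counter]
  spent u := by rcases eq_or_ne u v with rfl | hu <;> simp [*, h.spent]
  length_left a := by simp [h.length_left]
  arr a i := by simp [← h.arr]
  out := by simp [h.out]

theorem setArray (h : Represents env aux s pos S) (a : Ar) (l r : List Γ) {x : ℕ → Γ}
    (hx : ∀ i, (l.reverse ++ r).getD i default = x i) :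
    Represents env aux ⟨update s.arr a x, s.out⟩ (update pos a l.length)
      (update (update S (.left a) l) (.right a) r) where
  counter u := by simp [h.counter]
  spent u := by simp [h.spent]
  length_left b := by rcases eq_or_ne b a with rfl | hb <;> simp [*, h.length_left]
  arr b i := by
    rcases eq_or_ne b a with rfl | hb
    · simpa using hx i
    · simp [hb, ← h.arr]
  out := by simp [h.out]

theorem moveHead (h : Represents env aux s pos S) (a : Ar) (l r : List Γ)
    (hlr : ∀ i, (l.reverse ++ r).getD i default = s.arr a i) :
    Represents env aux s (update pos a l.length)
      (update (update S (.left a) l) (.right a) r) := by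
  simpa using h.setArray a l r hlr

theorem moveRight (h : Represents env aux s pos S) (a : Ar) :
    Represents env aux s (update pos a (pos a + 1)) ((StackProg.moveRight a).run n S) := by
  rw [← h.length_left]
  rcases hr : S (.right a) with _ | ⟨x, r⟩
  · have hrun : (StackProg.moveRight a).run n S =
        update (update S (.left a) (default :: S (.left a))) (.right a) [] := by
      simp [StackProg.moveRight, StackProg.run, hr]
    rw [hrun]
    refine h.moveHead a (default :: S (.left a)) [] fun i => ?_
    rw [← h.arr, hr, List.append_nil, List.append_nil, List.reverse_cons]
    rcases lt_or_ge i (S (.left a)).reverse.length with hi | hi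
    · rw [List.getD_append _ _ _ _ hi]
    · rw [List.getD_append_right _ _ _ _ hi, List.getD_eq_default _ _ hi]
      cases i - (S (.left a)).reverse.length <;> simp
  · have hrun : (StackProg.moveRight a).run n S =
        update (update S (.left a) (x :: S (.left a))) (.right a) r := by
      rw [update_comm (by simp)]
      simp [StackProg.moveRight, StackProg.run, hr]
    rw [hrun]
    exact h.moveHead a (x :: S (.left a)) r fun i => by simp [← h.arr, hr]

theorem moveLeft (h : Represents env aux s pos S) (a : Ar) :
    Represents env aux s (update pos a (pos a - 1)) ((StackProg.moveLeft a).run n S) := by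
  rw [← h.length_left]
  rcases hl : S (.left a) with _ | ⟨x, l⟩
  · have hpos : pos a = 0 := by rw [← h.length_left, hl, List.length_nil]
    have hupdate : update pos a 0 = pos := update_eq_self_iff.2 hpos.symm
    simpa [StackProg.moveLeft, StackProg.run, hl, hupdate] using h
  · have hrun : (StackProg.moveLeft a).run n S =
        update (update S (.left a) l) (.right a) (x :: S (.right a)) := by
      simp [StackProg.moveLeft, StackProg.run, hl]
    rw [hrun]
    exact h.moveHead a l (x :: S (.right a)) fun i => by simp [← h.arr, hl]

omit [DecidableEq V] [DecidableEq Ar] in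
theorem head_right (h : Represents env aux s pos S) (a : Ar) :
    (S (.right a)).head?.getD default = s.arr a (pos a) := by
  rw [← h.arr, ← h.length_left, List.getD_append_right _ _ _ _ (by simp)]
  cases S (.right a) <;> simp

theorem write (h : Represents env aux s pos S) (a : Ar) (x : Γ) :
    Represents env aux (s.put a (pos a) x) pos
      (update S (.right a) (x :: (S (.right a)).tail)) := by
  have hS : update (update S (.left a) (S (.left a))) (.right a) (x :: (S (.right a)).tail) =
      update S (.right a) (x :: (S (.right a)).tail) := by rw [update_eq_self]
  have hpos : update pos a (S (.left a)).length = pos := by rw [h.length_left, update_eq_self]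
  rw [← hS, ← hpos, update_self]
  refine h.setArray a _ _ fun i => ?_
  rw [update_apply, ← h.arr a i]
  rcases lt_trichotomy i (S (.left a)).length with hi | rfl | hi
  · simp [hi.ne, List.getElem?_append, hi]
  · simp
  · obtain ⟨j, rfl⟩ := Nat.exists_eq_add_of_lt hi
    simp [add_assoc, List.getElem?_append]

end Represents

/-- The program `P` moves the heads of the arrays as described by `g`, and changes nothing else. -/
def MovesHeads (n : ℕ) (P : StackProg (DataStack V Ar) Γ) (g : (Ar → ℕ) → Ar → ℕ) : Prop :=
  ∀ ⦃env aux : V → ℕ⦄ ⦃s pos S⦄,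
    Represents env aux s pos S → Represents env aux s (g pos) (P.run n S)

namespace MovesHeads

theorem moveRight (n : ℕ) (a : Ar) : MovesHeads n (.moveRight a : StackProg (DataStack V Ar) Γ)
    fun pos => update pos a (pos a + 1) := fun _ _ _ _ _ h => h.moveRight a

theorem moveLeft (n : ℕ) (a : Ar) : MovesHeads n (.moveLeft a : StackProg (DataStack V Ar) Γ)
    fun pos => update pos a (pos a - 1) := fun _ _ _ _ _ h => h.moveLeft a

variable {P : StackProg (DataStack V Ar) Γ} {g : (Ar → ℕ) → Ar → ℕ}

theorem iterate (hP : MovesHeads n P g) (h : Represents env aux s pos S) (m : ℕ) :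
    Represents env aux s (g^[m] pos) ((P.run n)^[m] S) := by
  induction m with
  | zero => exact h
  | succ m ih =>
    rw [iterate_succ_apply', iterate_succ_apply']
    exact hP ih

theorem nestedLoops (hP : MovesHeads n P g) (w : ℕ) :
    MovesHeads n (P.nestedLoops w) g^[n ^ w] := by
  induction w with
  | zero => simpa [StackProg.nestedLoops] using hP
  | succ w ih =>
    intro env aux s pos S h
    rw [pow_succ, iterate_mul]
    exact ih.iterate h n

theorem iterate_countDown (hP : MovesHeads n P g) (h : Represents env aux s pos S) (v : V)
    (m : ℕ) : Represents (update env v (env v - m)) (update aux v (aux v + min (env v) m)) s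
      (g^[min (env v) m] pos) (((P.countDown v).run n)^[m] S) := by
  induction m generalizing env aux pos S with
  | zero => simpa using h
  | succ m ih =>
    rw [iterate_succ_apply]
    rcases hv : env v with _ | k
    · have hrun : (P.countDown v).run n S = S := by
        simp [StackProg.countDown, StackProg.run, h.counter, hv]
      simpa [hv, hrun] using ih h
    · have hrun : (P.countDown v).run n S = P.run n (update (update S (.counter v)
          (List.replicate k default)) (.spent v) (List.replicate (aux v + 1) default)) := by
        simp [StackProg.countDown, StackProg.run, h.counter, h.spent, hv, List.replicate_succ]
      have := ih (hP ((h.setCounter v k).setSpent v (aux v + 1)))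
      rw [hrun, Nat.add_min_add_right, iterate_succ_apply, Nat.add_sub_add_right]
      simpa [add_assoc, add_comm 1] using this

end MovesHeads

namespace Represents

theorem iterate_countUp (h : Represents env aux s pos S) (v : V) (m : ℕ) :
    Represents (update env v (env v + min (aux v) m)) (update aux v (aux v - m)) s pos
      (((StackProg.countUp v).run n)^[m] S) := by
  induction m generalizing env aux S with
  | zero => simpa using h
  | succ m ih =>
    rw [iterate_succ_apply]
    rcases hv : aux v with _ | k
    · have hrun : (StackProg.countUp v).run n S = S := by
        simp [StackProg.countUp, StackProg.run, h.spent, hv]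
      simpa [hv, hrun] using ih h
    · have hrun : (StackProg.countUp v).run n S = update (update S (.spent v)
          (List.replicate k default)) (.counter v) (List.replicate (env v + 1) default) := by
        simp [StackProg.countUp, StackProg.run, h.counter, h.spent, hv, List.replicate_succ]
      have := ih ((h.setSpent v k).setCounter v (env v + 1))
      rw [hrun, Nat.add_min_add_right, Nat.add_sub_add_right]
      simpa [add_assoc, add_comm 1] using this

theorem walk {P : StackProg (DataStack V Ar) Γ} {g : (Ar → ℕ) → Ar → ℕ} (hP : MovesHeads n P g)
    (e : Position V) (h : Represents env 0 s pos S) :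
    Represents env 0 s (g^[e.offset n env] pos) ((P.walk e).run n S) := by
  induction e generalizing pos S with
  | nil => exact h
  | cons t e ih =>
    obtain ⟨_ | v, w⟩ := t
    · rw [Position.offset_none_cons, add_comm, iterate_add_apply]
      exact ih (hP.nestedLoops w h)
    · rw [Position.offset_some_cons, add_comm, iterate_add_apply, iterate_mul]
      refine ih ?_
      have hsum : env v - n + min (env v) n = env v := by lia
      simpa [StackProg.run, hsum] using
        ((hP.nestedLoops w).iterate_countDown h v n).iterate_countUp (n := n) v n

end Represents

theorem iterate_succ_update_zero (a : Ar) (k : ℕ) :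
    (fun pos : Ar → ℕ => update pos a (pos a + 1))^[k] 0 = update (0 : Ar → ℕ) a k := by
  induction k with
  | zero => simp
  | succ k ih => simp [iterate_succ_apply', ih]

theorem iterate_pred_update_zero (a : Ar) (k m : ℕ) :
    (fun pos : Ar → ℕ => update pos a (pos a - 1))^[k] (update (0 : Ar → ℕ) a m) =
      update (0 : Ar → ℕ) a (m - k) := by
  induction k with
  | zero => simp
  | succ k ih => simp [iterate_succ_apply', ih, Nat.sub_sub]

namespace Represents

theorem seek (h : Represents env 0 s 0 S) (a : Ar) (e : Position V) :
    Represents env 0 s (update (0 : Ar → ℕ) a (e.offset n env))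
      (((StackProg.moveRight a).walk e).run n S) := by
  simpa only [iterate_succ_update_zero] using h.walk (.moveRight n a) e

theorem rewind {a : Ar} {e : Position V}
    (h : Represents env 0 s (update (0 : Ar → ℕ) a (e.offset n env)) S) :
    Represents env 0 s 0 (((StackProg.moveLeft a).walk e).run n S) := by
  have := h.walk (.moveLeft n a) e
  rw [iterate_pred_update_zero, Nat.sub_self] at this
  simpa using this

theorem pushCounter (h : Represents env aux s pos S) (v : V) :
    Represents (update env v (env v + 1)) aux s pos
      (update S (.counter v) (default :: S (.counter v))) := by
  simpa [h.counter, List.replicate_succ] using h.setCounter v (env v + 1)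

theorem iterate_popCounter (h : Represents env aux s pos S) (v : V) (m : ℕ) :
    Represents (update env v (env v - m)) aux s pos
      (((StackProg.pop (.counter v)).run n)^[m] S) := by
  induction m generalizing env S with
  | zero => simpa using h
  | succ m ih =>
    have := ih (h.setCounter v (env v - 1))
    rw [iterate_succ_apply]
    simpa [StackProg.run, h.counter, Nat.sub_sub, add_comm 1] using this

theorem loop {v : V} {P : ArrayProg V Ar Γ}
    (hP : ∀ {env : V → ℕ} {s : Store Ar Γ} {S : DataStack V Ar → List Γ},
      Represents env 0 s 0 S → Represents env 0 (P.exec n env s) 0 (P.compile.run n S))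
    (h : Represents env 0 s 0 S) :
    Represents env 0 ((P.loop v).exec n env s) 0 ((P.loop v).compile.run n S) := by
  have hiter : ∀ m, Represents (update env v (env v + m)) 0
      ((List.range m).foldl (fun s i => P.exec n (update env v (env v + i)) s) s) 0
      (((StackProg.seq P.compile (.push (.counter v) default)).run n)^[m] S) := by
    intro m
    induction m with
    | zero => simpa using h
    | succ m ih =>
      rw [List.range_succ, List.foldl_append, iterate_succ_apply']
      simpa [StackProg.run, add_assoc] using (hP ih).pushCounter v
  simpa [ArrayProg.compile, StackProg.run, ArrayProg.exec] using
    (hiter n).iterate_popCounter (n := n) v n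

theorem compile (P : ArrayProg V Ar Γ) {env : V → ℕ} {s : Store Ar Γ}
    {S : DataStack V Ar → List Γ} (h : Represents env 0 s 0 S) :
    Represents env 0 (P.exec n env s) 0 (P.compile.run n S) := by
  induction P generalizing env s S with
  | skip => exact h
  | seq _ _ ihP ihQ => exact ihQ (ihP h)
  | set a e x =>
    have := ((h.seek (n := n) a e).write a x)
    rw [update_self] at this
    simpa [ArrayProg.compile, StackProg.run, ArrayProg.exec] using this.rewind
  | case a e f ih =>
    have hseek := h.seek (n := n) a e
    have hread := hseek.head_right a
    rw [update_self] at hread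
    simp only [ArrayProg.compile, StackProg.run, ArrayProg.exec, hread]
    exact ih _ hseek.rewind
  | loop v P ih => exact h.loop ih
  | emit x => exact ⟨h.counter, h.spent, h.length_left, h.arr,
      by simp [ArrayProg.compile, StackProg.run, ArrayProg.exec, h.out]⟩

theorem init (a : Ar) (x : List Γ) :
    Represents 0 0 (Store.init a x) (update (0 : Ar → ℕ) a x.length)
      (update (fun _ => []) (.left a) x.reverse : DataStack V Ar → List Γ) where
  counter := by simp
  spent := by simp
  length_left b := by rcases eq_or_ne b a with rfl | hb <;> simp [*]
  arr b i := by rcases eq_or_ne b a with rfl | hb <;> simp [*, Store.init]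
  out := by simp [Store.init]

end Represents

theorem ArrayProg.computableInPolyTime [Finite Γ] [Finite V] [Finite Ar] {I O α : Type} [Finite I]
    (ea : α → List I) (f : α → List O) (inSym : I → Γ) {osym : O → Γ} (hosym : Injective osym)
    (P : ArrayProg V Ar Γ) (a₀ : Ar)
    (hP : ∀ x, (P.exec ((ea x).length + 1) 0 (.init a₀ ((ea x).map inSym))).out =
      (f x).reverse.map osym) :
    Nonempty (TM2ComputableInPolyTime ea (fun w : List O => w) f) := by
  cases nonempty_fintype V
  cases nonempty_fintype Ar
  refine StackProg.computableInPolyTime (P := .seq (.loop (.moveLeft a₀)) P.compile)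
    (rin := .left a₀) (rout := .out) (inSym := inSym) ea f hosym (by simp) fun x => ?_
  rw [← hP x]
  refine (Represents.compile P ?_).out
  have := (MovesHeads.moveLeft ((ea x).length + 1) a₀).iterate
    (Represents.init (V := V) a₀ ((ea x).map inSym)) ((ea x).length + 1)
  rw [iterate_pred_update_zero, List.length_map, Nat.sub_eq_zero_of_le (Nat.le_succ _),
    ← List.map_reverse] at this
  simpa [StackProg.run] using this

end Compile

end ClosestElement

namespace ClosestElement

open Function

/-! ### Reasoning about loops -/

theorem foldl_range_induction {α : Type*} {n : ℕ} {f : α → ℕ → α} {s : α} (Inv : ℕ → α → Prop)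
    (h0 : Inv 0 s) (hsucc : ∀ i < n, ∀ t, Inv i t → Inv (i + 1) (f t i)) :
    Inv n ((List.range n).foldl f s) := by
  suffices h : ∀ m ≤ n, Inv m ((List.range m).foldl f s) from h n le_rfl
  intro m
  induction m with
  | zero => exact fun _ => h0
  | succ m ih =>
    intro hm
    rw [List.range_succ, List.foldl_append]
    exact hsucc m hm _ (ih (Nat.le_of_lt hm))

section Loops

variable {V Ar Γ : Type} [DecidableEq V] [DecidableEq Ar] {n : ℕ} {env : V → ℕ} {v : V}
  {P P' : ArrayProg V Ar Γ} {s t : Store Ar Γ}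

theorem ArrayProg.exec_loop_induction (hv : env v = 0) (Inv : ℕ → Store Ar Γ → Prop)
    (h0 : Inv 0 s) (hsucc : ∀ i < n, ∀ t, Inv i t → Inv (i + 1) (P.exec n (update env v i) t)) :
    Inv n ((P.loop v).exec n env s) :=
  foldl_range_induction Inv h0 (by simpa only [hv, zero_add] using hsucc)

/-- A monotone form of total correctness: run from any store above `s` for the preorder `R`, the
program `P` moves up and makes `Q` true once and for all. -/
def Ensures (R : Store Ar Γ → Store Ar Γ → Prop) (n : ℕ) (env : V → ℕ) (P : ArrayProg V Ar Γ)
    (s : Store Ar Γ) (Q : Store Ar Γ → Prop) : Prop :=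
  ∀ ⦃t⦄, R s t → R t (P.exec n env t) ∧ ∀ ⦃u⦄, R (P.exec n env t) u → Q u

namespace Ensures

variable {R : Store Ar Γ → Store Ar Γ → Prop} {Q Q' : Store Ar Γ → Prop}

theorem rel [Std.Refl R] (h : Ensures R n env P s Q) : R s (P.exec n env s) := (h (refl s)).1

theorem post [Std.Refl R] (h : Ensures R n env P s Q) : Q (P.exec n env s) :=
  (h (refl s)).2 (refl _)

theorem imp (h : Ensures R n env P s Q) (hQ : ∀ ⦃t⦄, Q t → Q' t) : Ensures R n env P s Q' :=
  fun _ ht => (h ht).imp_right fun h _ hu => hQ (h hu)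

theorem skip [Std.Refl R] [IsTrans _ R] (h : ∀ ⦃t⦄, R s t → Q t) : Ensures R n env .skip s Q :=
  fun t ht => ⟨refl t, fun _ hu => h (_root_.trans ht hu)⟩

theorem seq [IsTrans _ R] (h : Ensures R n env P s Q) (h' : Ensures R n env P' s Q') :
    Ensures R n env (P.seq P') s fun t => Q t ∧ Q' t := fun _ ht =>
  have hP := h ht
  have hP' := h' (_root_.trans ht hP.1)
  ⟨_root_.trans hP.1 hP'.1, fun _ hu => ⟨hP.2 (_root_.trans hP'.1 hu), hP'.2 hu⟩⟩

theorem loop [Std.Refl R] [IsTrans _ R] {Q : ℕ → Store Ar Γ → Prop} (hv : env v = 0)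
    (h : ∀ i < n, Ensures R n (update env v i) P s (Q i)) :
    Ensures R n env (P.loop v) s fun t => ∀ i < n, Q i t := by
  intro t ht
  refine ArrayProg.exec_loop_induction hv
    (fun m t' => R t t' ∧ ∀ ⦃u⦄, R t' u → ∀ i < m, Q i u) ⟨refl t, by simp⟩ ?_
  rintro m hm t' ⟨htt', hdone⟩
  have hstep := h m hm (_root_.trans ht htt')
  refine ⟨_root_.trans htt' hstep.1, fun u hu i hi => ?_⟩
  rcases Nat.lt_succ_iff_lt_or_eq.1 hi with hi | rfl
  · exact hdone (_root_.trans hstep.1 hu) i hi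
  · exact hstep.2 hu

theorem ite [Std.Refl R] [IsTrans _ R] {c : Prop} [Decidable c]
    (h : c → Ensures R n env P s Q) :
    Ensures R n env (if c then P else .skip) s fun t => c → Q t := by
  split_ifs with hc
  · exact (h hc).imp fun _ hQ _ => hQ
  · exact skip fun _ _ h => absurd h hc

end Ensures

end Loops

/-! ### Positions in tables -/

section Positions

theorem table_inj {n p q p' q' : ℕ} (hq : q < n) (hq' : q' < n) :
    p * n + q = p' * n + q' ↔ p = p' ∧ q = q' := by
  refine ⟨fun h => ?_, by rintro ⟨rfl, rfl⟩; rfl⟩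
  have hn : 0 < n := by lia
  have hdiv := congrArg (· / n) h
  have hmod := congrArg (· % n) h
  simp only [mul_comm _ n, Nat.mul_add_div hn, Nat.div_eq_of_lt, Nat.mul_add_mod,
    Nat.mod_eq_of_lt, hq, hq', add_zero] at hdiv hmod
  exact ⟨hdiv, hmod⟩

variable {V : Type} {n : ℕ} {env : V → ℕ}

/-- The position with one index. -/
def pos₁ (u : V) : Position V := [(some u, 0)]

/-- The position with two indices, row by row. -/
def pos₂ (u v : V) : Position V := [(some u, 1), (some v, 0)]

/-- The position with three indices, the last one varying fastest. -/
def pos₃ (u v w : V) : Position V := [(some u, 2), (some v, 1), (some w, 0)]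

theorem offset_pos₁ {u : V} (hu : env u < n) : (pos₁ u).offset n env = env u := by
  simp [Position.offset_some_cons, pos₁, hu.le]

theorem offset_pos₂ {u v : V} (hu : env u < n) (hv : env v < n) :
    (pos₂ u v).offset n env = env u * n + env v := by
  simp [Position.offset_some_cons, pos₂, hu.le, hv.le, mul_comm]

theorem offset_pos₃ {u v w : V} (hu : env u < n) (hv : env v < n) (hw : env w < n) :
    (pos₃ u v w).offset n env = (env u * n + env v) * n + env w := by
  simp only [Position.offset_some_cons, pos₃, hu.le, hv.le, hw.le, min_eq_left,
    Position.offset_nil]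
  ring

end Positions

/-! ### Tables of the algorithm -/

/-- The arrays of the algorithm. The vertices of the graph are the positions in the input.
* `inp` is the input;
* `seen` has a mark once the first word has been read;
* `start` marks the end of the first word;
* `edge` holds the labels of the edges;
* `fold` marks the pairs of vertices that have been identified;
* `layer` marks `(k, p)` if `p` is reached from the start by a word of length `k`;
* `word` holds such a word for each marked entry of `layer`;
* `done` has a mark once the second part of the output has been written. -/
inductive Table : Type
  | inp | seen | start | edge | fold | layer | word | done
  deriving DecidableEq

instance : Fintype Table :=
  ⟨{.inp, .seen, .start, .edge, .fold, .layer, .word, .done}, fun a => by cases a <;> simp⟩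

/-- The alphabet of the arrays: `none` is the blank, `some none` a mark that also serves as the
separator of words, and the other symbols are letters. -/
abbrev Symbol (L : Type) : Type := Option (Option L)

variable {L : Type}

/-- The mark. -/
abbrev mark : Symbol L := some none

/-- A letter as a symbol. -/
abbrev letter (y : L) : Symbol L := some (some y)

/-- Programs on the tables, with seven index variables. -/
abbrev TableProg (L : Type) : Type := ArrayProg (Fin 7) Table (Symbol L)

namespace TableProg

/-- Run a program if there is a mark. -/
def ifMark (a : Table) (e : Position (Fin 7)) (P : TableProg L) : TableProg L :=
  .case a e fun
    | some none => P
    | _ => .skip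

/-- Run a program that depends on a letter, if there is one. -/
def ifLetter (a : Table) (e : Position (Fin 7)) (P : L → TableProg L) : TableProg L :=
  .case a e fun
    | some (some y) => P y
    | _ => .skip

end TableProg

open TableProg

section Branch

variable {n : ℕ} {env : Fin 7 → ℕ} {s t : Store Table (Symbol L)} {a : Table}
  {e : Position (Fin 7)}

theorem exec_ifMark_pos {P : TableProg L} (h : s.arr a (e.offset n env) = mark) :
    (ifMark a e P).exec n env s = P.exec n env s := by
  simp [ifMark, ArrayProg.exec, h]

theorem exec_ifMark_neg {P : TableProg L} (h : s.arr a (e.offset n env) ≠ mark) :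
    (ifMark a e P).exec n env s = s := by
  simp only [ifMark, ArrayProg.exec]

theorem exec_ifLetter_pos {P : L → TableProg L} {y : L}
    (h : s.arr a (e.offset n env) = letter y) :
    (ifLetter a e P).exec n env s = (P y).exec n env s := by
  simp [ifLetter, ArrayProg.exec, h]

theorem exec_ifLetter_neg {P : L → TableProg L}
    (h : ∀ y, s.arr a (e.offset n env) ≠ letter y) :
    (ifLetter a e P).exec n env s = s := by
  simp only [ifLetter, ArrayProg.exec]

namespace Ensures

variable {R : Store Table (Symbol L) → Store Table (Symbol L) → Prop} [Std.Refl R]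

theorem ifMark {P : TableProg L} {Q : Store Table (Symbol L) → Prop}
    (hmark : ∀ ⦃t⦄, R s t → s.arr a (e.offset n env) = mark → t.arr a (e.offset n env) = mark)
    (h : ∀ ⦃t⦄, R s t → t.arr a (e.offset n env) = mark → Ensures R n env P t Q) :
    Ensures R n env (ifMark a e P) s fun t => s.arr a (e.offset n env) = mark → Q t := by
  intro t hst
  by_cases ht : t.arr a (e.offset n env) = mark
  · rw [exec_ifMark_pos ht]
    exact ((h hst ht) (refl t)).imp_right fun h _ hu _ => h hu
  · rw [exec_ifMark_neg ht]
    exact ⟨refl t, fun _ _ hs => absurd (hmark hst hs) ht⟩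

theorem ifLetter {P : L → TableProg L} {Q : L → Store Table (Symbol L) → Prop}
    (hletter : ∀ ⦃t⦄, R s t → t.arr a (e.offset n env) = s.arr a (e.offset n env))
    (h : ∀ y, s.arr a (e.offset n env) = letter y → Ensures R n env (P y) s (Q y)) :
    Ensures R n env (ifLetter a e P) s fun t =>
      ∀ y, s.arr a (e.offset n env) = letter y → Q y t := by
  intro t hst
  by_cases hs : ∃ y, s.arr a (e.offset n env) = letter y
  · obtain ⟨y, hy⟩ := hs
    rw [exec_ifLetter_pos ((hletter hst).trans hy)]
    refine (h y hy hst).imp_right fun h u hu z hz => ?_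
    obtain rfl : y = z := by simpa [hy] using hz
    exact h hu
  · rw [exec_ifLetter_neg (by simpa [hletter hst] using hs)]
    exact ⟨refl t, fun _ _ y hy => absurd ⟨y, hy⟩ hs⟩

end Ensures

end Branch

namespace Store

/-- The entry of the table `a` in row `p` and column `q`. -/
def tab (n : ℕ) (s : Store Table (Symbol L)) (a : Table) (p q : ℕ) : Symbol L :=
  s.arr a (p * n + q)

theorem tab_congr {n : ℕ} {s t : Store Table (Symbol L)} {a : Table} (h : t.arr a = s.arr a) :
    t.tab n a = s.tab n a := by
  funext p q
  rw [tab, tab, h]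

theorem tab_put_self {n p q p' q' : ℕ} (hq : q < n) (hq' : q' < n)
    (s : Store Table (Symbol L)) (a : Table) (c : Symbol L) :
    (s.put a (p * n + q) c).tab n a p' q' = if p' = p ∧ q' = q then c else s.tab n a p' q' := by
  simp only [tab, put_arr, update_self, update_apply, table_inj hq' hq]

theorem tab_put_of_ne {n i : ℕ} {a b : Table} (h : b ≠ a) (s : Store Table (Symbol L))
    (c : Symbol L) (p q : ℕ) : (s.put a i c).tab n b p q = s.tab n b p q := by
  simp only [tab, put_arr, update_of_ne h]

end Store

end ClosestElement

namespace ClosestElement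

open Function TableProg

/-! ### Folding -/

variable {L : Type} {n : ℕ}

/-- A relation on the vertices `p < n` that is closed under folding of a graph whose edges have
the labels `ed`: it is transitive, and edges with the same label that start at related vertices
end at related vertices. -/
structure FoldClosed (n : ℕ) (ed : ℕ → ℕ → Symbol L) (T : ℕ → ℕ → Prop) : Prop where
  trans : ∀ p < n, ∀ q < n, ∀ r < n, T p q → T q r → T p r
  fold : ∀ p < n, ∀ p' < n, ∀ q < n, ∀ q' < n, ∀ y, ed p p' = letter y → ed q q' = letter y →
    T p q → T p' q'

/-- `t` arises from `s` by adding pairs to the table of identified vertices that lie in every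
closed relation containing the pairs of `s`. -/
structure FoldExt (n : ℕ) (s t : Store Table (Symbol L)) : Prop where
  arr : ∀ a ≠ .fold, t.arr a = s.arr a
  out : t.out = s.out
  mono : ∀ ⦃i⦄, s.arr .fold i = mark → t.arr .fold i = mark
  sound : ∀ T, FoldClosed n (s.tab n .edge) T →
    (∀ p < n, ∀ q < n, s.tab n .fold p q = mark → T p q) →
    ∀ p < n, ∀ q < n, t.tab n .fold p q = mark → T p q

namespace FoldExt

theorem tab {s t : Store Table (Symbol L)} (h : FoldExt n s t) {a : Table} (ha : a ≠ .fold) :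
    t.tab n a = s.tab n a :=
  Store.tab_congr (h.arr a ha)

instance : Std.Refl (FoldExt (L := L) n) :=
  ⟨fun _ => ⟨fun _ _ => rfl, rfl, fun _ h => h, fun _ _ h => h⟩⟩

instance : IsTrans _ (FoldExt (L := L) n) where
  trans s t u h₁ h₂ := by
    refine ⟨fun a ha => (h₂.arr a ha).trans (h₁.arr a ha), h₂.out.trans h₁.out,
      fun i h => h₂.mono (h₁.mono h), fun T hT h => ?_⟩
    refine h₂.sound T ?_ (h₁.sound T hT h)
    rwa [h₁.tab (by simp)]

theorem put {s : Store Table (Symbol L)} {p q : ℕ} (hq : q < n)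
    (h : ∀ T, FoldClosed n (s.tab n .edge) T →
      (∀ p < n, ∀ q < n, s.tab n .fold p q = mark → T p q) → T p q) :
    FoldExt n s (s.put .fold (p * n + q) mark) where
  arr a ha := by simp [ha]
  out := rfl
  mono i hi := by
    simp only [Store.put_arr, update_self, update_apply]
    split_ifs <;> trivial
  sound T hT hs p' hp' q' hq' hpq := by
    rw [Store.tab_put_self hq hq'] at hpq
    split_ifs at hpq with hc
    · rw [hc.1, hc.2]
      exact h T hT hs
    · exact hs p' hp' q' hq' hpq

end FoldExt

section FoldRound

variable {env : Fin 7 → ℕ} {s : Store Table (Symbol L)}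

theorem ensures_set_fold {u v : Fin 7} (hu : env u < n) (hv : env v < n)
    (h : ∀ T, FoldClosed n (s.tab n .edge) T →
      (∀ p < n, ∀ q < n, s.tab n .fold p q = mark → T p q) → T (env u) (env v)) :
    Ensures (FoldExt n) n env (.set .fold (pos₂ u v) mark) s
      fun t => t.tab n .fold (env u) (env v) = mark := by
  intro t hst
  rw [ArrayProg.exec, offset_pos₂ hu hv]
  refine ⟨FoldExt.put hv fun T hT ht => ?_, fun _ hu => hu.mono (by simp)⟩
  rw [hst.tab (by simp)] at hT
  exact h T hT fun p hp q hq hpq => ht p hp q hq (hst.mono hpq)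

/-- The first half of a round of folding: compose the relation in the table with itself. -/
def composeFolds : TableProg L :=
  .loop 0 <| .loop 1 <| .loop 2 <| ifMark .fold (pos₂ 0 1) <| ifMark .fold (pos₂ 1 2) <|
    .set .fold (pos₂ 0 2) mark

/-- The second half of a round of folding: for two edges with the same label that start at
identified vertices, identify the vertices where they end. -/
def foldEdges [DecidableEq L] : TableProg L :=
  .loop 0 <| .loop 1 <| .loop 2 <| .loop 3 <| ifLetter .edge (pos₂ 0 1) fun y =>
    ifLetter .edge (pos₂ 2 3) fun z =>
      if y = z then ifMark .fold (pos₂ 0 2) (.set .fold (pos₂ 1 3) mark) else .skip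

/-- One round of folding. -/
def foldRound [DecidableEq L] : TableProg L := .seq composeFolds foldEdges

theorem ensures_composeFolds_body (h0 : env 0 < n) (h1 : env 1 < n) (h2 : env 2 < n) :
    Ensures (FoldExt n) n env
      (ifMark .fold (pos₂ 0 1) <| ifMark .fold (pos₂ 1 2) <| .set .fold (pos₂ 0 2) mark) s
      fun t => s.tab n .fold (env 0) (env 1) = mark → s.tab n .fold (env 1) (env 2) = mark →
        t.tab n .fold (env 0) (env 2) = mark := by
  simp only [Store.tab, ← offset_pos₂ h0 h1, ← offset_pos₂ h1 h2]
  refine .ifMark (fun _ h => (h.mono ·)) fun t hst h01 => .imp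
    (.ifMark (fun _ h => (h.mono ·)) fun u htu h12 => ensures_set_fold h0 h2 fun T hT h => ?_)
    fun u hu hs => hu (hst.mono hs)
  rw [offset_pos₂ h0 h1] at h01
  rw [offset_pos₂ h1 h2] at h12
  exact hT.trans _ h0 _ h1 _ h2 (h _ h0 _ h1 (htu.mono h01)) (h _ h1 _ h2 h12)

theorem ensures_composeFolds (h0 : env 0 = 0) (h1 : env 1 = 0) (h2 : env 2 = 0) :
    Ensures (FoldExt n) n env composeFolds s fun t => ∀ p < n, ∀ q < n, ∀ r < n,
      s.tab n .fold p q = mark → s.tab n .fold q r = mark → t.tab n .fold p r = mark :=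
  .loop h0 fun p hp => .loop (by simp [h1]) fun q hq => .loop (by simp [h2]) fun r hr => by
    simpa using ensures_composeFolds_body (env := update (update (update env 0 p) 1 q) 2 r)
      (by simpa) (by simpa) (by simpa)

theorem ensures_foldEdges_body [DecidableEq L] (h0 : env 0 < n) (h1 : env 1 < n) (h2 : env 2 < n)
    (h3 : env 3 < n) :
    Ensures (FoldExt n) n env
      (ifLetter .edge (pos₂ 0 1) fun y => ifLetter .edge (pos₂ 2 3) fun z =>
        if y = z then ifMark .fold (pos₂ 0 2) (.set .fold (pos₂ 1 3) mark) else .skip) s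
      fun t => ∀ y, s.tab n .edge (env 0) (env 1) = letter y → ∀ z,
        s.tab n .edge (env 2) (env 3) = letter z → y = z →
          s.tab n .fold (env 0) (env 2) = mark → t.tab n .fold (env 1) (env 3) = mark := by
  have hedge : ∀ i ⦃t : Store Table (Symbol L)⦄, FoldExt n s t →
      t.arr .edge i = s.arr .edge i := fun i _ h => congrFun (h.arr .edge (by simp)) i
  simp only [Store.tab, ← offset_pos₂ h0 h1, ← offset_pos₂ h2 h3, ← offset_pos₂ h0 h2]
  refine .ifLetter (hedge _) fun y hy => .ifLetter (hedge _) fun z hz => .ite fun hyz =>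
    .ifMark (fun _ h => (h.mono ·)) fun t hst h02 => ensures_set_fold h1 h3 fun T hT h => ?_
  rw [offset_pos₂ h0 h1] at hy
  rw [offset_pos₂ h2 h3] at hz
  rw [offset_pos₂ h0 h2] at h02
  rw [hst.tab (by simp)] at hT
  exact hT.fold _ h0 _ h1 _ h2 _ h3 y hy (hyz ▸ hz) (h _ h0 _ h2 h02)

theorem ensures_foldEdges [DecidableEq L] (h0 : env 0 = 0) (h1 : env 1 = 0) (h2 : env 2 = 0)
    (h3 : env 3 = 0) :
    Ensures (FoldExt n) n env foldEdges s fun t => ∀ p < n, ∀ p' < n, ∀ q < n, ∀ q' < n,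
      ∀ y, s.tab n .edge p p' = letter y → ∀ z, s.tab n .edge q q' = letter z → y = z →
        s.tab n .fold p q = mark → t.tab n .fold p' q' = mark :=
  .loop h0 fun p hp => .loop (by simp [h1]) fun p' hp' => .loop (by simp [h2]) fun q hq =>
    .loop (by simp [h3]) fun q' hq' => by
      simpa using ensures_foldEdges_body
        (env := update (update (update (update env 0 p) 1 p') 2 q) 3 q')
        (by simpa) (by simpa) (by simpa) (by simpa)

theorem ensures_foldRound [DecidableEq L] (h0 : env 0 = 0) (h1 : env 1 = 0) (h2 : env 2 = 0)
    (h3 : env 3 = 0) :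
    Ensures (FoldExt n) n env foldRound s fun t =>
      (∀ p < n, ∀ q < n, ∀ r < n, s.tab n .fold p q = mark → s.tab n .fold q r = mark →
        t.tab n .fold p r = mark) ∧
      ∀ p < n, ∀ p' < n, ∀ q < n, ∀ q' < n, ∀ y, s.tab n .edge p p' = letter y →
        s.tab n .edge q q' = letter y → s.tab n .fold p q = mark → t.tab n .fold p' q' = mark :=
  ((ensures_composeFolds h0 h1 h2).seq (ensures_foldEdges h0 h1 h2 h3)).imp fun _ h =>
    ⟨h.1, fun p hp p' hp' q hq q' hq' y hy hz => h.2 p hp p' hp' q hq q' hq' y hy y hz rfl⟩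

end FoldRound

namespace Store

open Classical in
/-- The set of pairs of vertices that have been identified. -/
noncomputable def folded (n : ℕ) (s : Store Table (Symbol L)) : Finset (ℕ × ℕ) :=
  (Finset.range n ×ˢ Finset.range n).filter fun x => s.tab n .fold x.1 x.2 = mark

theorem mem_folded {s : Store Table (Symbol L)} {p q : ℕ} :
    (p, q) ∈ s.folded n ↔ (p < n ∧ q < n) ∧ s.tab n .fold p q = mark := by
  simp [folded]

theorem card_folded_le (s : Store Table (Symbol L)) : (s.folded n).card ≤ n * n := by
  classical
  have hsub : s.folded n ⊆ Finset.range n ×ˢ Finset.range n := Finset.filter_subset _ _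
  simpa using Finset.card_le_card hsub

/-- The identified pairs form a relation that is closed under folding. -/
def IsFolded (n : ℕ) (s : Store Table (Symbol L)) : Prop :=
  FoldClosed n (s.tab n .edge) fun p q => s.tab n .fold p q = mark

end Store

theorem FoldExt.folded_subset {s t : Store Table (Symbol L)} (h : FoldExt n s t) :
    s.folded n ⊆ t.folded n := by
  rintro ⟨p, q⟩ hpq
  rw [Store.mem_folded] at hpq ⊢
  exact ⟨hpq.1, h.mono hpq.2⟩

theorem FoldExt.folded_eq {s t : Store Table (Symbol L)} (h : FoldExt n s t)
    (hs : s.IsFolded n) : t.folded n = s.folded n := by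
  refine Finset.Subset.antisymm ?_ h.folded_subset
  rintro ⟨p, q⟩ hpq
  rw [Store.mem_folded] at hpq ⊢
  exact ⟨hpq.1, h.sound _ hs (fun _ _ _ _ h => h) p hpq.1.1 q hpq.1.2 hpq.2⟩

section FoldAll

variable [DecidableEq L] {env : Fin 7 → ℕ} {s : Store Table (Symbol L)}

theorem isFolded_foldRound (h0 : env 0 = 0) (h1 : env 1 = 0) (h2 : env 2 = 0) (h3 : env 3 = 0)
    (h : (foldRound.exec n env s).folded n = s.folded n) :
    (foldRound.exec n env s).IsFolded n := by
  have hround := ensures_foldRound h0 h1 h2 h3 (s := s) (n := n)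
  obtain ⟨htrans, hfold⟩ := hround.post
  have hback : ∀ p < n, ∀ q < n, (foldRound.exec n env s).tab n .fold p q = mark →
      s.tab n .fold p q = mark := fun p hp q hq hpq =>
    (Store.mem_folded.1 (h ▸ Store.mem_folded.2 ⟨⟨hp, hq⟩, hpq⟩)).2
  refine ⟨fun p hp q hq r hr hpq hqr =>
    htrans p hp q hq r hr (hback p hp q hq hpq) (hback q hq r hr hqr), ?_⟩
  rw [hround.rel.tab (by simp)]
  exact fun p hp p' hp' q hq q' hq' y hy hz hpq =>
    hfold p hp p' hp' q hq q' hq' y hy hz (hback p hp q hq hpq)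

theorem isFolded_foldRound_or_card_le {m : ℕ} (h0 : env 0 = 0) (h1 : env 1 = 0)
    (h2 : env 2 = 0) (h3 : env 3 = 0) (h : s.IsFolded n ∨ m ≤ (s.folded n).card) :
    (foldRound.exec n env s).IsFolded n ∨ m + 1 ≤ ((foldRound.exec n env s).folded n).card := by
  have hext := (ensures_foldRound h0 h1 h2 h3 (s := s) (n := n)).rel
  by_cases heq : (foldRound.exec n env s).folded n = s.folded n
  · exact .inl (isFolded_foldRound h0 h1 h2 h3 heq)
  · refine .inr ((h.resolve_left fun hs => heq (hext.folded_eq hs)).trans_lt ?_)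
    exact Finset.card_lt_card (hext.folded_subset.ssubset_of_ne (Ne.symm heq))

/-- Sufficiently many rounds of folding. -/
def foldAll : TableProg L := .loop 4 <| .loop 5 <| .loop 6 foldRound

theorem foldExt_foldAll : FoldExt n s (foldAll.exec n 0 s) :=
  Ensures.rel <| .loop (Pi.zero_apply _) fun _ _ => .loop (by simp) fun _ _ =>
    .loop (by simp) fun _ _ => ensures_foldRound (by simp) (by simp) (by simp) (by simp)

-- A round that does not close the relation adds a pair to it, and there are only `n ^ 2` pairs.
theorem isFolded_foldAll (hn : 2 ≤ n) : (foldAll.exec n 0 s).IsFolded n := by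
  suffices h : (foldAll.exec n 0 s).IsFolded n ∨
      n * (n * n) ≤ ((foldAll.exec n 0 s).folded n).card from
    h.resolve_right fun h => by nlinarith [h.trans (Store.card_folded_le _)]
  refine ArrayProg.exec_loop_induction (Pi.zero_apply _)
    (fun i t => t.IsFolded n ∨ i * (n * n) ≤ (t.folded n).card) (.inr (by simp)) fun i _ t ht => ?_
  rw [Nat.succ_mul]
  refine ArrayProg.exec_loop_induction (by simp)
    (fun j t => t.IsFolded n ∨ i * (n * n) + j * n ≤ (t.folded n).card) (by simpa using ht)
    fun j _ t ht => ?_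
  rw [Nat.succ_mul, ← add_assoc]
  exact ArrayProg.exec_loop_induction (by simp)
    (fun k t => t.IsFolded n ∨ i * (n * n) + j * n + k ≤ (t.folded n).card) (by simpa using ht)
    fun k _ t ht =>
      isFolded_foldRound_or_card_le (by simp) (by simp) (by simp) (by simp) ht

end FoldAll

end ClosestElement

namespace ClosestElement

open Function TableProg

/-! ### Layers of the folded graph -/

variable {L : Type} {n : ℕ}

/-- `Reach n ed E e u p`: starting from the vertex `e`, one gets to `p` along edges with labels
`ed` that spell the word `u`, where after the start and after each edge one passes to a vertex that
is related by `E`. -/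
inductive Reach (n : ℕ) (ed : ℕ → ℕ → Symbol L) (E : ℕ → ℕ → Prop) (e : ℕ) : List L → ℕ → Prop
  | nil {p : ℕ} : p < n → E e p → Reach n ed E e [] p
  | snoc {u : List L} {p q r : ℕ} {y : L} : Reach n ed E e u p → q < n → ed p q = letter y →
      r < n → E q r → Reach n ed E e (u ++ [y]) r

theorem Reach.lt {ed : ℕ → ℕ → Symbol L} {E : ℕ → ℕ → Prop} {e : ℕ} {u : List L} {p : ℕ}
    (h : Reach n ed E e u p) : p < n := by
  cases h <;> assumption

namespace Store

/-- Reachability in the graph that is stored in the tables of edges and of identified vertices. -/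
def Reach (n : ℕ) (s : Store Table (Symbol L)) (e : ℕ) : List L → ℕ → Prop :=
  ClosestElement.Reach n (s.tab n .edge) (fun p q => s.tab n .fold p q = mark) e

/-- The entry number `j` of the word for the vertex `p` in layer `k`. -/
def wordAt (n : ℕ) (s : Store Table (Symbol L)) (k p j : ℕ) : Symbol L :=
  s.arr .word ((k * n + p) * n + j)

theorem wordAt_put {k r i k' p j : ℕ} (hr : r < n) (hi : i < n) (hp : p < n) (hj : j < n)
    (s : Store Table (Symbol L)) (c : Symbol L) :
    (s.put .word ((k * n + r) * n + i) c).wordAt n k' p j =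
      if k' = k ∧ p = r ∧ j = i then c else s.wordAt n k' p j := by
  simp only [wordAt, put_arr, update_self, update_apply, table_inj hj hi, table_inj hp hr,
    and_assoc]

/-- The words that are stored for the marked entries of the layers satisfy `R`, and those in
layer 0 are empty. -/
def WordsCorrect (n : ℕ) (R : List L → ℕ → Prop) (s : Store Table (Symbol L)) : Prop :=
  (∀ p < n, ∀ j < n, s.wordAt n 0 p j = none) ∧ ∀ k, ∀ p < n, s.tab n .layer k p = mark →
    ∃ u, R u p ∧ u.length = k ∧ ∀ j < n, s.wordAt n k p j = (u[j]?).map some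

end Store

section ExtendWord

/-- `t` arises from `s` by changing the word of the vertex `r` in layer `k`. -/
structure WordUpdate (n k r : ℕ) (s t : Store Table (Symbol L)) : Prop where
  arr : ∀ a ≠ .word, t.arr a = s.arr a
  out : t.out = s.out
  wordAt : ∀ k', ∀ p < n, ∀ j < n, k' ≠ k ∨ p ≠ r → t.wordAt n k' p j = s.wordAt n k' p j

theorem WordUpdate.refl {k r : ℕ} (s : Store Table (Symbol L)) : WordUpdate n k r s s :=
  ⟨fun _ _ => rfl, rfl, fun _ _ _ _ _ _ => rfl⟩

theorem WordUpdate.put {k r i : ℕ} {s t : Store Table (Symbol L)} (h : WordUpdate n k r s t)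
    (hr : r < n) (hi : i < n) (c : Symbol L) :
    WordUpdate n k r s (t.put .word ((k * n + r) * n + i) c) := by
  refine ⟨fun a ha => by simp [ha, h.arr], h.out, fun k' p hp j hj hne => ?_⟩
  rw [Store.wordAt_put hr hi hp hj, if_neg (by tauto), h.wordAt k' p hp j hj hne]

variable {env : Fin 7 → ℕ}

theorem offset_succ_pos₂ {u v : Fin 7} (hu : env u < n) (hv : env v < n) :
    Position.offset n env ((none, 1) :: pos₂ u v) = (env u + 1) * n + env v := by
  rw [Position.offset_none_cons, offset_pos₂ hu hv]
  ring

theorem offset_succ_pos₃ {u v w : Fin 7} (hu : env u < n) (hv : env v < n) (hw : env w < n) :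
    Position.offset n env ((none, 2) :: pos₃ u v w) =
      ((env u + 1) * n + env v) * n + env w := by
  rw [Position.offset_none_cons, offset_pos₃ hu hv hw]
  ring

/-- With `k, p, r` the values of the index variables `0, 1, 3`: copy the word of the vertex `p` in
layer `k` to the vertex `r` in layer `k + 1`. -/
def copyWord : TableProg L :=
  .loop 4 <| .case .word (pos₃ 0 1 4) fun c => .set .word ((none, 2) :: pos₃ 0 3 4) c

/-- Copy a word as in `copyWord`, and append the letter `y`. -/
def extendWord (y : L) : TableProg L :=
  .seq copyWord (.set .word ((none, 2) :: pos₃ 0 3 0) (letter y))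

theorem exec_copyWord (h0 : env 0 < n) (h1 : env 1 < n) (h3 : env 3 < n) (h4 : env 4 = 0)
    (s : Store Table (Symbol L)) :
    WordUpdate n (env 0 + 1) (env 3) s (copyWord.exec n env s) ∧ ∀ j < n,
      (copyWord.exec n env s).wordAt n (env 0 + 1) (env 3) j = s.wordAt n (env 0) (env 1) j := by
  suffices h : WordUpdate n (env 0 + 1) (env 3) s (copyWord.exec n env s) ∧ ∀ j < n, j < n →
      (copyWord.exec n env s).wordAt n (env 0 + 1) (env 3) j = s.wordAt n (env 0) (env 1) j from
    ⟨h.1, fun j hj => h.2 j hj hj⟩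
  refine ArrayProg.exec_loop_induction h4 (fun i t => WordUpdate n (env 0 + 1) (env 3) s t ∧
    ∀ j < n, j < i → t.wordAt n (env 0 + 1) (env 3) j = s.wordAt n (env 0) (env 1) j)
    ⟨.refl s, by simp⟩ ?_
  rintro i hi t ⟨ht, hword⟩
  have hsrc : (pos₃ 0 1 4).offset n (update env 4 i) = (env 0 * n + env 1) * n + i := by
    rw [offset_pos₃] <;> simp [*]
  have hdst : Position.offset n (update env 4 i) ((none, 2) :: pos₃ 0 3 4) =
      ((env 0 + 1) * n + env 3) * n + i := by
    rw [offset_succ_pos₃] <;> simp [*]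
  simp only [ArrayProg.exec, hsrc, hdst]
  refine ⟨ht.put h3 hi _, fun j hj hji => ?_⟩
  rw [Store.wordAt_put h3 hi h3 hj]
  split_ifs with hc
  · rw [hc.2.2]
    exact ht.wordAt _ _ h1 _ hi (by simp)
  · exact hword j hj (by lia)

theorem exec_extendWord (h0 : env 0 < n) (h1 : env 1 < n) (h3 : env 3 < n) (h4 : env 4 = 0)
    (y : L) (s : Store Table (Symbol L)) :
    WordUpdate n (env 0 + 1) (env 3) s ((extendWord y).exec n env s) ∧ ∀ j < n,
      ((extendWord y).exec n env s).wordAt n (env 0 + 1) (env 3) j =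
        if j = env 0 then letter y else s.wordAt n (env 0) (env 1) j := by
  obtain ⟨hupdate, hword⟩ := exec_copyWord h0 h1 h3 h4 s
  simp only [extendWord, ArrayProg.exec, offset_succ_pos₃ h0 h3 h0]
  refine ⟨hupdate.put h3 h0 _, fun j hj => ?_⟩
  simp [Store.wordAt_put h3 h0 h3 hj, hword j hj]

end ExtendWord

/-- `t` arises from `s` by marking further entries of the layers; if the words of `s` are correct,
so are those of `t`. -/
structure LayerExt (n : ℕ) (R : List L → ℕ → Prop) (s t : Store Table (Symbol L)) : Prop where
  arr : ∀ a, a ≠ .layer → a ≠ .word → t.arr a = s.arr a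
  out : t.out = s.out
  mono : ∀ ⦃i⦄, s.arr .layer i = mark → t.arr .layer i = mark
  words : s.WordsCorrect n R → t.WordsCorrect n R

namespace LayerExt

variable {R : List L → ℕ → Prop} {s t : Store Table (Symbol L)}

instance : Std.Refl (LayerExt n R) :=
  ⟨fun _ => ⟨fun _ _ _ => rfl, rfl, fun _ h => h, fun h => h⟩⟩

instance : IsTrans _ (LayerExt n R) where
  trans _ _ _ h₁ h₂ := ⟨fun a ha ha' => (h₂.arr a ha ha').trans (h₁.arr a ha ha'),
    h₂.out.trans h₁.out, fun _ h => h₂.mono (h₁.mono h), fun h => h₂.words (h₁.words h)⟩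

theorem tab (h : LayerExt n R s t) {a : Table} (ha : a ≠ .layer) (ha' : a ≠ .word) :
    t.tab n a = s.tab n a :=
  Store.tab_congr (h.arr a ha ha')

theorem of_wordUpdate {k r : ℕ} (hr : r < n)
    (h : WordUpdate n k r (s.put .layer (k * n + r) mark) t)
    (hword : s.WordsCorrect n R → ∃ u, R u r ∧ u.length = k ∧
      ∀ j < n, t.wordAt n k r j = (u[j]?).map some) : LayerExt n R s t where
  arr a ha ha' := by simp [h.arr a ha', ha]
  out := h.out
  mono i hi := by
    simp only [h.arr .layer (by simp), Store.put_arr, update_self, update_apply]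
    split_ifs <;> trivial
  words hs := by
    obtain ⟨u, hu, hlen, hut⟩ := hword hs
    have hother : ∀ k', ∀ p < n, ∀ j < n, k' ≠ k ∨ p ≠ r →
        t.wordAt n k' p j = s.wordAt n k' p j := fun k' p hp j hj hne =>
      (h.wordAt k' p hp j hj hne).trans (by simp [Store.wordAt])
    refine ⟨fun p hp j hj => ?_, fun k' p hp hmark => ?_⟩
    · by_cases hc : 0 = k ∧ p = r
      · obtain ⟨rfl, rfl⟩ := hc
        simp [hut j hj, List.length_eq_zero_iff.1 hlen]
      · rw [hother 0 p hp j hj (by tauto), hs.1 p hp j hj]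
    · by_cases hc : k' = k ∧ p = r
      · obtain ⟨rfl, rfl⟩ := hc
        exact ⟨u, hu, hlen, hut⟩
      · rw [Store.tab_congr (h.arr .layer (by simp)), Store.tab_put_self hr hp, if_neg hc] at hmark
        obtain ⟨v, hv, hvlen, hvs⟩ := hs.2 k' p hp hmark
        exact ⟨v, hv, hvlen, fun j hj =>
          (hother k' p hp j hj (by tauto)).trans (hvs j hj)⟩

end LayerExt

section LayerSteps

variable {env : Fin 7 → ℕ} {R : List L → ℕ → Prop} {s : Store Table (Symbol L)}

theorem ensures_set_layer_zero {v : Fin 7} (hv : env v < n) (hR : R [] (env v)) :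
    Ensures (LayerExt n R) n env (.set .layer (pos₁ v) mark) s
      fun t => t.tab n .layer 0 (env v) = mark := by
  intro t _
  have hpos : (pos₁ v).offset n env = 0 * n + env v := by rw [offset_pos₁ hv, zero_mul, zero_add]
  rw [ArrayProg.exec, hpos]
  refine ⟨.of_wordUpdate hv (.refl _) fun ht => ⟨[], hR, rfl, fun j hj => ?_⟩,
    fun u hu => hu.mono (by simp)⟩
  simpa [Store.wordAt] using ht.1 _ hv j hj

/-- With `k, p, r` as in `copyWord`: mark the vertex `r` in layer `k + 1`, and store the word of
`p` in layer `k` followed by `y` as its word. -/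
def extendPath (y : L) : TableProg L :=
  .seq (.set .layer ((none, 1) :: pos₂ 0 3) mark) (extendWord y)

theorem ensures_extendPath {y : L} (h0 : env 0 < n) (h1 : env 1 < n) (h3 : env 3 < n)
    (h4 : env 4 = 0) (hmark : s.tab n .layer (env 0) (env 1) = mark)
    (hR : ∀ u, R u (env 1) → R (u ++ [y]) (env 3)) :
    Ensures (LayerExt n R) n env (extendPath y) s
      fun t => t.tab n .layer (env 0 + 1) (env 3) = mark := by
  intro t hst
  rw [extendPath, ArrayProg.exec, ArrayProg.exec, offset_succ_pos₂ h0 h3]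
  obtain ⟨hupdate, hword⟩ :=
    exec_extendWord h0 h1 h3 h4 y (t.put .layer ((env 0 + 1) * n + env 3) mark)
  refine ⟨.of_wordUpdate h3 hupdate fun ht => ?_, fun u hu => hu.mono ?_⟩
  · obtain ⟨u, hu, hlen, hut⟩ := ht.2 _ _ h1 (hst.mono hmark)
    refine ⟨u ++ [y], hR u hu, by simp [hlen], fun j hj => ?_⟩
    have hcopy : (t.put .layer ((env 0 + 1) * n + env 3) mark).wordAt n (env 0) (env 1) j =
        (u[j]?).map some := hut j hj
    rw [hword j hj, hcopy, ← hlen]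
    grind
  · rw [hupdate.arr .layer (by simp)]
    simp

/-- Mark the vertices that are identified with a vertex marked in `start` in layer 0. -/
def startLayer : TableProg L :=
  .loop 0 <| ifMark .start (pos₁ 0) <| .loop 1 <| ifMark .fold (pos₂ 0 1) <|
    .set .layer (pos₁ 1) mark

/-- Extend the words of the layer given by the index variable `0` along the edges of the folded
graph. -/
def nextLayer : TableProg L :=
  .loop 1 <| ifMark .layer (pos₂ 0 1) <| .loop 2 <| ifLetter .edge (pos₂ 1 2) fun y =>
    .loop 3 <| ifMark .fold (pos₂ 2 3) <| extendPath y

/-- Compute the layers: the entry `(k, p)` of the table is marked if the vertex `p` can be reached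
by a word of length `k`, and then such a word is stored in `word`. -/
def layers : TableProg L := .seq startLayer (.loop 0 nextLayer)

theorem ensures_startLayer_body (h0 : env 0 < n) (h1 : env 1 < n)
    (hR : s.tab n .fold (env 0) (env 1) = mark → R [] (env 1)) :
    Ensures (LayerExt n R) n env (ifMark .fold (pos₂ 0 1) <| .set .layer (pos₁ 1) mark) s
      fun t => s.tab n .fold (env 0) (env 1) = mark → t.tab n .layer 0 (env 1) = mark := by
  simp only [Store.tab, ← offset_pos₂ h0 h1] at hR ⊢
  have hfold : ∀ i ⦃t : Store Table (Symbol L)⦄, LayerExt n R s t →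
      t.arr .fold i = s.arr .fold i := fun i t h => congrFun (h.arr .fold (by simp) (by simp)) i
  exact .ifMark (fun t hst hmark => (hfold _ hst).trans hmark) fun t hst hmark =>
    ensures_set_layer_zero h1 (hR ((hfold _ hst).symm.trans hmark))

theorem ensures_startLayer {e : ℕ} (he : e < n) (hstart : ∀ p < n, s.arr .start p = mark ↔ p = e)
    (h0 : env 0 = 0) (h1 : env 1 = 0) :
    Ensures (LayerExt n (s.Reach n e)) n env startLayer s
      fun t => ∀ p < n, s.tab n .fold e p = mark → t.tab n .layer 0 p = mark := by
  have hpos : ∀ i < n, (pos₁ 0).offset n (update env 0 i) = i := fun i hi => by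
    rw [offset_pos₁] <;> simp [*]
  have hrow : ∀ i < n, i = e → ∀ ⦃t⦄, LayerExt n (s.Reach n e) s t →
      Ensures (LayerExt n (s.Reach n e)) n (update env 0 i)
        (.loop 1 <| ifMark .fold (pos₂ 0 1) <| .set .layer (pos₁ 1) mark) t
        fun u => ∀ p < n, s.tab n .fold e p = mark → u.tab n .layer 0 p = mark := by
    rintro _ _ rfl t hst
    rw [← hst.tab (a := .fold) (by simp) (by simp)]
    refine .loop (by simp [h1]) fun p hp => ?_
    simpa using ensures_startLayer_body (env := update (update env 0 _) 1 p) (s := t)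
      (by simpa) (by simpa) (by simpa [hst.tab, Store.Reach] using fun h => .nil hp h)
  refine .imp (.loop h0 fun i hi => .ifMark (fun t hst => ?_) fun t hst hmark =>
    hrow i hi ?_ hst) fun t ht => ?_
  · rw [hst.arr .start (by simp) (by simp)]
    exact id
  · rwa [hst.arr .start (by simp) (by simp), hpos i hi, hstart i hi] at hmark
  · refine ht e he ?_
    rw [hpos e he, hstart e he]

section NextLayer

variable {s₀ : Store Table (Symbol L)} {e : ℕ}

theorem ensures_extendPaths {y : L} (hs : LayerExt n (s₀.Reach n e) s₀ s) (h0 : env 0 < n)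
    (h1 : env 1 < n) (h2 : env 2 < n) (h3 : env 3 = 0) (h4 : env 4 = 0)
    (hmark : s.tab n .layer (env 0) (env 1) = mark)
    (hy : s₀.tab n .edge (env 1) (env 2) = letter y) :
    Ensures (LayerExt n (s₀.Reach n e)) n env
      (.loop 3 <| ifMark .fold (pos₂ 2 3) <| extendPath y) s
      fun t => ∀ r < n, s₀.tab n .fold (env 2) r = mark →
        t.tab n .layer (env 0 + 1) r = mark := by
  refine .loop h3 fun r hr => ?_
  have hpos : (pos₂ 2 3).offset n (update env 3 r) = env 2 * n + r := by
    rw [offset_pos₂] <;> simp [*]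
  have hfold : ∀ ⦃t⦄, LayerExt n (s₀.Reach n e) s t →
      t.arr .fold = s₀.arr .fold := fun _ hst =>
    (_root_.trans hs hst).arr .fold (by simp) (by simp)
  refine .imp (.ifMark (fun t hst => ?_) fun t hst hfoldt =>
    ensures_extendPath (env := update env 3 r) (by simpa) (by simpa) (by simpa) (by simpa)
      (by simpa [Store.tab] using hst.mono hmark) fun u hu => ?_) fun t ht => ?_
  · rw [hfold hst, hfold (refl s)]
    exact id
  · rw [hpos, hfold hst] at hfoldt
    simpa [Store.Reach] using Reach.snoc (by simpa [Store.Reach] using hu) h2 hy hr hfoldt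
  · rw [hpos, hfold (refl s)] at ht
    simpa [Store.tab] using ht

theorem ensures_extendVertex (hs : LayerExt n (s₀.Reach n e) s₀ s) (h0 : env 0 < n)
    (h1 : env 1 < n) (h2 : env 2 = 0) (h3 : env 3 = 0) (h4 : env 4 = 0)
    (hmark : s.tab n .layer (env 0) (env 1) = mark) :
    Ensures (LayerExt n (s₀.Reach n e)) n env
      (.loop 2 <| ifLetter .edge (pos₂ 1 2) fun y =>
        .loop 3 <| ifMark .fold (pos₂ 2 3) <| extendPath y) s
      fun t => ∀ q < n, ∀ y, s₀.tab n .edge (env 1) q = letter y → ∀ r < n,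
        s₀.tab n .fold q r = mark → t.tab n .layer (env 0 + 1) r = mark := by
  have hpos : ∀ q < n, (pos₂ 1 2).offset n (update env 2 q) = env 1 * n + q := fun q hq => by
    rw [offset_pos₂] <;> simp [*]
  have hedge := hs.arr .edge (by simp) (by simp)
  refine .imp (.loop h2 fun q hq => .ifLetter (fun t hst => ?_) fun y hy =>
    ensures_extendPaths (env := update env 2 q) hs (by simpa) (by simpa) (by simpa) (by simpa)
      (by simpa) (by simpa) ?_) fun t ht q hq y hy => ?_
  · rw [hst.arr .edge (by simp) (by simp)]
  · simpa [hpos q hq, hedge, Store.tab] using hy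
  · simpa using ht q hq y (by rwa [hpos q hq, hedge])

theorem ensures_nextLayer (hs : LayerExt n (s₀.Reach n e) s₀ s) (h0 : env 0 < n)
    (h1 : env 1 = 0) (h2 : env 2 = 0) (h3 : env 3 = 0) (h4 : env 4 = 0) :
    Ensures (LayerExt n (s₀.Reach n e)) n env nextLayer s
      fun t => ∀ p < n, s.tab n .layer (env 0) p = mark → ∀ q < n, ∀ y,
        s₀.tab n .edge p q = letter y → ∀ r < n, s₀.tab n .fold q r = mark →
          t.tab n .layer (env 0 + 1) r = mark := by
  have hpos : ∀ p < n, (pos₂ 0 1).offset n (update env 1 p) = env 0 * n + p := fun p hp => by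
    rw [offset_pos₂] <;> simp [*]
  refine .imp (.loop h1 fun p hp => .ifMark (fun t hst => (hst.mono ·)) fun t hst hmark =>
    ensures_extendVertex (env := update env 1 p) (_root_.trans hs hst) (by simpa) (by simpa)
      (by simpa) (by simpa) (by simpa) ?_) fun t ht p hp hmark => ?_
  · simpa [hpos p hp, Store.tab] using hmark
  · simpa using ht p hp (by rwa [hpos p hp])

end NextLayer

end LayerSteps

theorem exec_layers {e : ℕ} (he : e < n) {s : Store Table (Symbol L)}
    (hstart : ∀ p < n, s.arr .start p = mark ↔ p = e) :
    LayerExt n (s.Reach n e) s (layers.exec n 0 s) ∧ ∀ u p, s.Reach n e u p → u.length ≤ n →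
      (layers.exec n 0 s).tab n .layer u.length p = mark := by
  have hzero := ensures_startLayer he hstart (env := 0) rfl rfl
  refine ArrayProg.exec_loop_induction (Pi.zero_apply _)
    (fun k t => LayerExt n (s.Reach n e) s t ∧ ∀ u p, s.Reach n e u p → u.length ≤ k →
      t.tab n .layer u.length p = mark) ⟨hzero.rel, fun u p hu hk => ?_⟩ ?_
  · cases hu with
    | nil hp hE => exact hzero.post p hp hE
    | snoc => simp at hk
  rintro k hk t ⟨hst, hlayers⟩
  have hnext := ensures_nextLayer (env := update 0 0 k) hst (by simpa) (by simp) (by simp)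
    (by simp) (by simp)
  refine ⟨_root_.trans hst hnext.rel, fun u p hu hlen => ?_⟩
  rcases Nat.lt_succ_iff_lt_or_eq.1 (Nat.lt_succ_of_le hlen) with hlt | heq
  · exact hnext.rel.mono (hlayers u p hu (Nat.le_of_lt_succ hlt))
  · cases hu with
    | nil => simp at heq
    | snoc hu hq hy hr hE =>
      obtain rfl : _ = k := by simpa using heq
      simpa using hnext.post _ hu.lt (by simpa using hlayers _ _ hu le_rfl) _ hq _ hy _ hr hE

end ClosestElement

namespace ClosestElement

open Function TableProg

/-! ### Output of the second factor -/

variable {L : Type} {n : ℕ}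

/-- Emit the word of the base vertex in the layer given by the index variable `0`. -/
def emitWord : TableProg L :=
  .loop 1 <| ifLetter .word [(some 0, 2), (some 1, 0)] fun y => .emit (letter y)

/-- Emit the word of the base vertex in the layer given by the index variable `0` if the base vertex
is marked there, unless a word has been emitted before. -/
def outputLayer : TableProg L :=
  .case .done [] fun
    | none => ifMark .layer [(some 0, 1)] <| .seq (.set .done [] mark) emitWord
    | some _ => .skip

/-- Emit the word of the base vertex in the first layer in which it is marked. -/
def outputWord : TableProg L := .loop 0 outputLayer

theorem exec_emitWord {env : Fin 7 → ℕ} {s : Store Table (Symbol L)} {u : List L}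
    (h0 : env 0 < n) (h1 : env 1 = 0) (hlen : u.length ≤ n)
    (hu : ∀ j < n, s.wordAt n (env 0) 0 j = (u[j]?).map some) :
    (emitWord.exec n env s).arr = s.arr ∧
      (emitWord.exec n env s).out = u.reverse.map letter ++ s.out := by
  suffices h : (emitWord.exec n env s).arr = s.arr ∧
      (emitWord.exec n env s).out = (u.take n).reverse.map letter ++ s.out by
    rwa [List.take_of_length_le hlen] at h
  refine ArrayProg.exec_loop_induction h1
    (fun j t => t.arr = s.arr ∧ t.out = (u.take j).reverse.map letter ++ s.out)
    ⟨rfl, by simp⟩ ?_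
  rintro j hj t ⟨harr, hout⟩
  have hpos : Position.offset n (update env 1 j) [(some 0, 2), (some 1, 0)] =
      (env 0 * n + 0) * n + j := by
    simp only [Fin.isValue, Position.offset_some_cons, ne_eq, zero_ne_one, not_false_eq_true,
      update_of_ne, h0.le, inf_of_le_left, pow_zero, update_self, hj.le, one_mul,
      Position.offset_nil, add_zero, Nat.add_right_cancel_iff]
    ring
  have hword : t.arr .word ((env 0 * n + 0) * n + j) = (u[j]?).map some := by
    rw [harr, ← hu j hj, Store.wordAt]
  rcases hj' : u[j]? with _ | y
  · rw [exec_ifLetter_neg (by rw [hpos, hword, hj']; simp), hout,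
      List.take_of_length_le (List.getElem?_eq_none_iff.1 hj'),
      List.take_of_length_le ((List.getElem?_eq_none_iff.1 hj').trans j.le_succ)]
    exact ⟨harr, rfl⟩
  · rw [exec_ifLetter_pos (y := y) (by rw [hpos, hword, hj']; rfl)]
    exact ⟨harr, by simp [ArrayProg.exec, hout, List.take_add_one, hj']⟩

/-- The store after the layers `k < i` of the store `s` have been searched for the base vertex:
either it has not been found, or a word of minimal length has been emitted. -/
inductive OutputInv (n : ℕ) (R : List L → ℕ → Prop) (s : Store Table (Symbol L)) (i : ℕ)
    (t : Store Table (Symbol L)) : Prop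
  | searching : (∀ a ≠ .done, t.arr a = s.arr a) → t.arr .done 0 = none → t.out = s.out →
      (∀ k < i, s.tab n .layer k 0 ≠ mark) → OutputInv n R s i t
  | found (u : List L) : t.arr .done 0 = mark → R u 0 → t.out = u.reverse.map letter ++ s.out →
      (∀ k < u.length, s.tab n .layer k 0 ≠ mark) → OutputInv n R s i t

theorem OutputInv.exec_outputLayer {env : Fin 7 → ℕ} {R : List L → ℕ → Prop}
    {s t : Store Table (Symbol L)} (hs : s.WordsCorrect n R) (h0 : env 0 < n) (h1 : env 1 = 0)
    (h : OutputInv n R s (env 0) t) :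
    OutputInv n R s (env 0 + 1) (outputLayer.exec n env t) := by
  rcases h with ⟨harr, hdone, hout, hlayers⟩ | ⟨u, hdone, hu, hout, hmin⟩
  · have hpos : Position.offset n env [(some 0, 1)] = env 0 * n + 0 := by
      simp [Position.offset_some_cons, h0.le, mul_comm]
    have hlayer := Store.tab_congr (n := n) (harr .layer (by simp))
    simp only [outputLayer, ArrayProg.exec, Position.offset_nil, hdone]
    by_cases hmark : s.tab n .layer (env 0) 0 = mark
    · rw [exec_ifMark_pos (by rwa [hpos, ← Store.tab, hlayer])]
      obtain ⟨u, hu, hlen, hword⟩ := hs.2 _ 0 (by lia) hmark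
      obtain ⟨hemit, hemitOut⟩ := exec_emitWord (s := t.put .done 0 mark) h0 h1
        (hlen.trans_le h0.le) (by simpa [Store.wordAt, harr] using hword)
      exact .found u (by simp [ArrayProg.exec, hemit]) hu
        (by simp [ArrayProg.exec, hemitOut, hout]) (hlen ▸ hlayers)
    · rw [exec_ifMark_neg (by rwa [hpos, ← Store.tab, hlayer])]
      exact .searching harr hdone hout fun k hk =>
        (Nat.lt_succ_iff_lt_or_eq.1 hk).elim (hlayers k) fun h => h ▸ hmark
  · simp only [outputLayer, ArrayProg.exec, Position.offset_nil, hdone]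
    exact .found u hdone hu hout hmin

theorem exec_outputWord {R : List L → ℕ → Prop} {s : Store Table (Symbol L)}
    (hs : s.WordsCorrect n R) (hdone : s.arr .done 0 = none)
    (hex : ∃ k < n, s.tab n .layer k 0 = mark) :
    ∃ u, R u 0 ∧ (outputWord.exec n 0 s).out = u.reverse.map letter ++ s.out ∧
      ∀ k < u.length, s.tab n .layer k 0 ≠ mark := by
  have hinv : OutputInv n R s n (outputWord.exec n 0 s) :=
    ArrayProg.exec_loop_induction (Pi.zero_apply _) (OutputInv n R s)
      (.searching (fun _ _ => rfl) hdone rfl (by simp)) fun i hi t ht => by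
        simpa using OutputInv.exec_outputLayer (env := update 0 0 i) hs (by simpa) (by simp)
          (by simpa using ht)
  rcases hinv with ⟨-, -, -, hnone⟩ | ⟨u, -, hu, hout, hmin⟩
  · obtain ⟨k, hk, hmark⟩ := hex
    exact absurd hmark (hnone k hk)
  · exact ⟨u, hu, hout, hmin⟩

end ClosestElement

namespace ClosestElement

open Function TableProg

/-! ### The graph of the input -/

variable {L : Type} {n : ℕ}

/-- Enter the end of a word: it becomes the starting vertex if no separator has been read before,
and is related to the base vertex otherwise. The next vertex is related to the base vertex. -/
def readSeparator : TableProg L :=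
  .seq
    (.case .seen [] fun
      | none => .seq (.set .seen [] mark) (.set .start (pos₁ 0) mark)
      | some _ => .seq (.set .fold [(some 0, 1)] mark) (.set .fold (pos₁ 0) mark))
    (.seq (.set .fold [(none, 1), (some 0, 1)] mark) (.set .fold ((none, 0) :: pos₁ 0) mark))

/-- Enter the edges in both directions for a letter, which is also emitted if no separator has been
read before. -/
def readLetter (inv : L → L) (y : L) : TableProg L :=
  .seq (.set .edge ((none, 0) :: pos₂ 0 0) (letter y)) <|
    .seq (.set .edge ((none, 1) :: pos₂ 0 0) (letter (inv y))) <|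
      .case .seen [] fun
        | none => .emit (letter y)
        | some _ => .skip

/-- Read the input: write the first word, and enter the graph and the initial fold relation. -/
def setup (inv : L → L) : TableProg L :=
  .loop 0 <| .seq (.set .fold (pos₂ 0 0) mark) <| .case .inp (pos₁ 0) fun
    | none => .skip
    | some none => readSeparator
    | some (some y) => readLetter inv y

/-- The vertex `p` is an end of a word other than the first one. Here `x` is the input, the first
word has length `e`, and only the first `i` symbols of the input are taken into account; the symbol
`x[p]` leads from the vertex `p` to the vertex `p + 1`. -/
def IsBase (x : List (Option L)) (e i p : ℕ) : Prop :=
  (p < i ∧ x[p]? = some none ∧ p ≠ e) ∨ ∃ p', p = p' + 1 ∧ p' < i ∧ x[p']? = some none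

/-- The initial fold relation, which identifies the ends of all words but the first one with the
base vertex `0`. -/
def Linked (x : List (Option L)) (e i p q : ℕ) : Prop :=
  (p = q ∧ p < i) ∨ (q = 0 ∧ IsBase x e i p) ∨ (p = 0 ∧ IsBase x e i q)

/-- There is an edge with label `y` from `p` to `q`, which comes from a letter of the input, or is
the inverse of such an edge. -/
def IsEdge (inv : L → L) (x : List (Option L)) (i p q : ℕ) (y : L) : Prop :=
  (q = p + 1 ∧ p < i ∧ x[p]? = some (some y)) ∨
    (p = q + 1 ∧ q < i ∧ ∃ z, x[q]? = some (some z) ∧ inv z = y)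

/-- The store after the first `i` symbols of the input `x` have been read, where the first word is
`g`. -/
structure SetupInv (n : ℕ) (inv : L → L) (x : List (Option L)) (g : List L) (i : ℕ)
    (s : Store Table (Symbol L)) : Prop where
  inp : ∀ j, s.arr .inp j = x[j]?
  seen : s.arr .seen 0 = if i ≤ g.length then none else mark
  start : ∀ j, s.arr .start j = mark ↔ j = g.length ∧ j < i
  edge : ∀ p < n, ∀ q < n, ∀ y, s.tab n .edge p q = letter y ↔ IsEdge inv x i p q y
  fold : ∀ p < n, ∀ q < n, s.tab n .fold p q = mark ↔ Linked x g.length i p q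
  layer : ∀ j, s.arr .layer j = none
  word : ∀ j, s.arr .word j = none
  done : s.arr .done 0 = none
  out : s.out = (g.take i).reverse.map letter

section Input

variable {inv : L → L} {x : List (Option L)} {e i p q : ℕ}

theorem isBase_succ : IsBase x e (i + 1) p ↔
    IsBase x e i p ∨ (x[i]? = some none ∧ ((p = i ∧ i ≠ e) ∨ p = i + 1)) := by
  unfold IsBase
  grind

theorem linked_succ : Linked x e (i + 1) p q ↔
    Linked x e i p q ∨ (p = i ∧ q = i) ∨ (x[i]? = some none ∧
      ((q = 0 ∧ ((p = i ∧ i ≠ e) ∨ p = i + 1)) ∨ (p = 0 ∧ ((q = i ∧ i ≠ e) ∨ q = i + 1)))) := by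
  unfold Linked
  rw [isBase_succ, isBase_succ]
  grind

theorem isEdge_succ {y : L} : IsEdge inv x (i + 1) p q y ↔
    IsEdge inv x i p q y ∨ (p = i ∧ q = i + 1 ∧ x[i]? = some (some y)) ∨
      (p = i + 1 ∧ q = i ∧ ∃ z, x[i]? = some (some z) ∧ inv z = y) := by
  unfold IsEdge
  grind

theorem IsEdge.lt {y : L} (h : IsEdge inv x i p q y) : p < i + 1 ∧ q < i + 1 := by
  unfold IsEdge at h
  grind

theorem getElem?_map_append_of_lt {g : List L} {rest : List (Option L)} (hi : i < g.length) :
    (g.map some ++ none :: rest)[i]? = some g[i]? := by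
  rw [List.getElem?_append_left (by simpa using hi)]
  simp [hi]

theorem getElem?_map_append_length {g : List L} {rest : List (Option L)} :
    (g.map some ++ none :: rest)[g.length]? = some none := by
  simp

end Input

section Positions

variable {env : Fin 7 → ℕ}

theorem offset_row (h : env 0 < n) : Position.offset n env [(some 0, 1)] = env 0 * n + 0 := by
  simp [Position.offset_some_cons, h.le, mul_comm]

theorem offset_row_succ (h : env 0 < n) :
    Position.offset n env [(none, 1), (some 0, 1)] = (env 0 + 1) * n + 0 := by
  rw [Position.offset_none_cons, offset_row h]
  ring

theorem offset_column (h : env 0 < n) : (pos₁ 0).offset n env = 0 * n + env 0 := by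
  rw [offset_pos₁] <;> simp [h]

theorem offset_column_succ (h : env 0 < n) :
    Position.offset n env ((none, 0) :: pos₁ 0) = 0 * n + (env 0 + 1) := by
  rw [Position.offset_none_cons, offset_column h]
  ring

theorem offset_edge (h : env 0 < n) :
    Position.offset n env ((none, 0) :: pos₂ 0 0) = env 0 * n + (env 0 + 1) := by
  rw [Position.offset_none_cons, offset_pos₂ h h]
  ring

theorem offset_edge_inv (h : env 0 < n) :
    Position.offset n env ((none, 1) :: pos₂ 0 0) = (env 0 + 1) * n + env 0 := by
  rw [Position.offset_none_cons, offset_pos₂ h h]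
  ring

end Positions

namespace SetupInv

variable {inv : L → L} {x : List (Option L)} {g : List L} {i : ℕ} {env : Fin 7 → ℕ}
  {s : Store Table (Symbol L)}

theorem init (n : ℕ) (inv : L → L) (x : List (Option L)) (g : List L) :
    SetupInv n inv x g 0 (.init .inp (x.map some)) where
  inp j := by
    rcases h : x[j]? with _ | c <;> simp [Store.init, h, Option.default_eq_none]
  seen := by simp [Store.init, Option.default_eq_none]
  start := by simp [Store.init]
  edge := by simp [Store.init, Store.tab, IsEdge]
  fold := by simp [Store.init, Store.tab, Linked, IsBase]
  layer := by simp [Store.init, Option.default_eq_none]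
  word := by simp [Store.init, Option.default_eq_none]
  done := by simp [Store.init, Option.default_eq_none]
  out := by simp [Store.init]

theorem succ_of_blank (h : SetupInv n inv x g i s) (hi : i < n) (hx : x[i]? = none)
    (hg : g.length < i) : SetupInv n inv x g (i + 1) (s.put .fold (i * n + i) mark) where
  inp := by simp [h.inp]
  seen := by simp [h.seen, hg.le, hg.not_ge]
  start j := by
    simp only [Store.put_arr, ne_eq, reduceCtorEq, not_false_eq_true, update_of_ne, h.start]
    lia
  edge p hp q hq z := by
    rw [Store.tab_put_of_ne (by simp), h.edge p hp q hq, isEdge_succ]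
    simp [hx]
  fold p hp q hq := by
    rw [Store.tab_put_self hi hq, linked_succ, ← h.fold p hp q hq]
    grind
  layer := by simp [h.layer]
  word := by simp [h.word]
  done := by simp [h.done]
  out := by rw [Store.put_out, h.out, List.take_of_length_le hg.le,
    List.take_of_length_le (by lia)]

theorem exec_readSeparator_of_eq (h : SetupInv n inv x g (env 0) s) (hi : env 0 + 1 < n)
    (hx : x[env 0]? = some none) (hg : g.length = env 0) :
    SetupInv n inv x g (env 0 + 1)
      (readSeparator.exec n env (s.put .fold (env 0 * n + env 0) mark)) := by
  have hi' : env 0 < n := by lia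
  have hseen : (s.put .fold (env 0 * n + env 0) mark).arr .seen 0 = none := by simp [h.seen, hg]
  simp only [readSeparator, ArrayProg.exec, Position.offset_nil, hseen, offset_row_succ hi',
    offset_column_succ hi', offset_pos₁ hi']
  constructor
  case edge =>
    intro p hp q hq z
    simp [Store.tab_put_of_ne, h.edge p hp q hq, isEdge_succ, hx]
  case fold =>
    intro p hp q hq
    rw [Store.tab_put_self hi hq, Store.tab_put_self (by lia) hq, Store.tab_put_of_ne (by simp),
      Store.tab_put_of_ne (by simp), Store.tab_put_self hi' hq, linked_succ, ← h.fold p hp q hq]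
    grind
  case start =>
    intro j
    have := h.start j
    simp only [add_zero, zero_mul, zero_add, Store.put_arr, ne_eq, reduceCtorEq, not_false_eq_true,
      update_of_ne, update_self, update_apply, ite_eq_left_iff]
    grind
  case out => simp [h.out, List.take_of_length_le, hg.le, hg.le.trans (Nat.le_succ _)]
  all_goals simp [h.inp, h.layer, h.word, h.done, hg]

theorem exec_readSeparator_of_lt (h : SetupInv n inv x g (env 0) s) (hi : env 0 + 1 < n)
    (hx : x[env 0]? = some none) (hg : g.length < env 0) :
    SetupInv n inv x g (env 0 + 1)
      (readSeparator.exec n env (s.put .fold (env 0 * n + env 0) mark)) := by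
  have hi' : env 0 < n := by lia
  have hseen : (s.put .fold (env 0 * n + env 0) mark).arr .seen 0 = mark := by
    simp [h.seen, hg.not_ge]
  simp only [readSeparator, ArrayProg.exec, Position.offset_nil, hseen, offset_row_succ hi',
    offset_column_succ hi', offset_row hi', offset_column hi']
  constructor
  case edge =>
    intro p hp q hq z
    simp [Store.tab_put_of_ne, h.edge p hp q hq, isEdge_succ, hx]
  case fold =>
    intro p hp q hq
    rw [Store.tab_put_self hi hq, Store.tab_put_self (by lia) hq, Store.tab_put_self hi' hq,
      Store.tab_put_self (by lia) hq, Store.tab_put_self hi' hq, linked_succ, ← h.fold p hp q hq]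
    grind
  case start =>
    intro j
    simp only [add_zero, zero_mul, zero_add, Store.put_arr, update_self, update_idem, ne_eq,
      reduceCtorEq, not_false_eq_true, update_of_ne, h.start]
    lia
  case out =>
    simp [h.out, List.take_of_length_le, hg.le, hg.le.trans (Nat.le_succ _)]
  all_goals simp [h.inp, h.layer, h.word, h.done, h.seen, hg.not_ge, hg.le]

theorem of_readLetter (h : SetupInv n inv x g i s) (hi : i + 1 < n) {y : L}
    (hx : x[i]? = some (some y)) (hg : i ≠ g.length) {t : Store Table (Symbol L)}
    (harr : t.arr = (((s.put .fold (i * n + i) mark).put .edge (i * n + (i + 1)) (letter y)).put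
      .edge ((i + 1) * n + i) (letter (inv y))).arr)
    (hout : t.out = (g.take (i + 1)).reverse.map letter) : SetupInv n inv x g (i + 1) t := by
  have htab := fun a => Store.tab_congr (n := n) (congrFun harr a)
  constructor
  case seen =>
    have hle : i ≤ g.length ↔ i + 1 ≤ g.length := by lia
    simp [harr, h.seen, hle]
  case start =>
    intro j
    simp only [harr, Store.put_arr, ne_eq, reduceCtorEq, not_false_eq_true, update_of_ne,
      update_self, h.start]
    lia
  case edge =>
    intro p hp q hq z
    rw [htab, Store.tab_put_self (by lia) hq, Store.tab_put_self hi hq,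
      Store.tab_put_of_ne (by simp), isEdge_succ]
    have hedge := h.edge p hp q hq
    have hlt : IsEdge inv x i p q z → p < i + 1 ∧ q < i + 1 := IsEdge.lt
    grind
  case fold =>
    intro p hp q hq
    rw [htab, Store.tab_put_of_ne (by simp), Store.tab_put_of_ne (by simp),
      Store.tab_put_self (by lia) hq, linked_succ, ← h.fold p hp q hq]
    grind
  case out => exact hout
  all_goals simp [harr, h.inp, h.layer, h.word, h.done]

theorem exec_readLetter (h : SetupInv n inv x g (env 0) s) (hi : env 0 + 1 < n) {y : L}
    (hx : x[env 0]? = some (some y)) (hg : env 0 ≠ g.length)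
    (hy : env 0 < g.length → g[env 0]? = some y) :
    SetupInv n inv x g (env 0 + 1)
      ((readLetter inv y).exec n env (s.put .fold (env 0 * n + env 0) mark)) := by
  have hi' : env 0 < n := by lia
  simp only [readLetter, ArrayProg.exec, Position.offset_nil, offset_edge hi', offset_edge_inv hi',
    Store.put_arr, ne_eq, reduceCtorEq, not_false_eq_true, update_of_ne, h.seen]
  split_ifs with hle
  · refine h.of_readLetter hi hx hg rfl ?_
    simp [ArrayProg.exec, h.out, List.take_add_one, hy (hle.lt_of_ne hg)]
  · refine h.of_readLetter hi hx hg rfl ?_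
    simp [ArrayProg.exec, h.out, List.take_of_length_le, (not_le.1 hle).le,
      (not_le.1 hle).le.trans (Nat.le_succ _)]

end SetupInv

theorem setupInv_exec_setup (inv : L → L) {x : List (Option L)} {g : List L}
    {rest : List (Option L)} (hx : x = g.map some ++ none :: rest) (hn : x.length < n) :
    SetupInv n inv x g n ((setup inv).exec n 0 (.init .inp (x.map some))) := by
  have hagree : ∀ i < g.length, x[i]? = some g[i]? := fun i hi =>
    hx ▸ getElem?_map_append_of_lt hi
  have hsep : x[g.length]? = some none := hx ▸ getElem?_map_append_length
  have hlt : ∀ {i c}, x[i]? = some c → i + 1 < n := fun h => by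
    have := (List.getElem?_eq_some_iff.1 h).1
    lia
  refine ArrayProg.exec_loop_induction (Pi.zero_apply _) (SetupInv n inv x g) (.init ..) ?_
  intro i hi s hs
  have h0 : update (0 : Fin 7 → ℕ) 0 i 0 = i := by simp
  generalize update (0 : Fin 7 → ℕ) 0 i = env at h0 ⊢
  subst h0
  have hinp : (s.put .fold (env 0 * n + env 0) mark).arr .inp (env 0) = x[env 0]? := by
    simp [hs.inp]
  simp only [ArrayProg.exec, offset_pos₂ hi hi, offset_pos₁ hi, hinp]
  have hcases := lt_trichotomy (env 0) g.length
  rcases hxi : x[env 0]? with _ | _ | y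
  · exact hs.succ_of_blank hi hxi (by grind)
  · rcases hcases with hg | hg | hg
    · simp [hagree _ hg, hg] at hxi
    · exact hs.exec_readSeparator_of_eq (hlt hxi) hxi hg.symm
    · exact hs.exec_readSeparator_of_lt (hlt hxi) hxi hg
  · exact hs.exec_readLetter (hlt hxi) hxi (by grind) fun hg => by
      simpa [hagree _ hg] using hxi

end ClosestElement

namespace ClosestElement

open Function TableProg

/-! ### Paths in folded graphs -/

variable {L : Type} {n : ℕ} {ed : ℕ → ℕ → Symbol L} {E : ℕ → ℕ → Prop}

/-- A graph on the vertices `p < n` with edge labels `ed`, in which every edge has an inverse edge,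
together with an equivalence relation `E` on the vertices such that the quotient graph is folded. -/
structure FoldedGraph (n : ℕ) (inv : L → L) (ed : ℕ → ℕ → Symbol L) (E : ℕ → ℕ → Prop) : Prop
    extends FoldClosed n ed E where
  refl : ∀ p < n, E p p
  symm : ∀ p < n, ∀ q < n, E p q → E q p
  edge_inv : ∀ p < n, ∀ q < n, ∀ y, ed p q = letter y → ed q p = letter (inv y)

namespace Reach

variable {inv : L → L} {a b c : ℕ} {u v : List L} {y : L}

theorem extend (hE : FoldClosed n ed E) (ha : a < n) (h : Reach n ed E a u b) (hc : c < n)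
    (hbc : E b c) : Reach n ed E a u c := by
  cases h with
  | nil hb hab => exact .nil hc (hE.trans a ha b hb c hc hab hbc)
  | snoc h hq hy hb hqb => exact .snoc h hq hy hc (hE.trans _ hq b hb c hc hqb hbc)

theorem trans (hE : FoldClosed n ed E) (ha : a < n) (h : Reach n ed E a u b)
    (h' : Reach n ed E b v c) : Reach n ed E a (u ++ v) c := by
  induction h' with
  | nil hc hbc =>
    rw [List.append_nil]
    exact h.extend hE ha hc hbc
  | snoc _ hq hy hr hqr ih =>
    rw [← List.append_assoc]
    exact .snoc ih hq hy hr hqr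

theorem exists_of_nil (h : Reach n ed E a [] b) : b < n ∧ E a b := by
  generalize hw : ([] : List L) = w at h
  cases h with
  | nil hb hab => exact ⟨hb, hab⟩
  | snoc => simp at hw

theorem exists_of_append_singleton (h : Reach n ed E a (u ++ [y]) c) :
    ∃ p q, Reach n ed E a u p ∧ q < n ∧ ed p q = letter y ∧ c < n ∧ E q c := by
  generalize hw : u ++ [y] = w at h
  cases h with
  | nil => simp at hw
  | snoc h hq hy hr hqr =>
    obtain ⟨rfl, hlast⟩ := List.append_inj' hw rfl
    obtain rfl : y = _ := by simpa using hlast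
    exact ⟨_, _, h, hq, hy, hr, hqr⟩

theorem exists_of_append (hrefl : ∀ p < n, E p p) (h : Reach n ed E a (u ++ v) c) :
    ∃ m, Reach n ed E a u m ∧ Reach n ed E m v c := by
  induction v using List.reverseRecOn generalizing c with
  | nil =>
    rw [List.append_nil] at h
    exact ⟨c, h, .nil h.lt (hrefl c h.lt)⟩
  | append_singleton v y ih =>
    rw [← List.append_assoc] at h
    obtain ⟨p, q, hp, hq, hy, hc, hqc⟩ := h.exists_of_append_singleton
    obtain ⟨m, hm, hmp⟩ := ih hp
    exact ⟨m, hm, .snoc hmp hq hy hc hqc⟩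

-- The path along the edges `y` and `inv y` returns to the class of its start by folding.
theorem rel_of_pair (hE : FoldedGraph n inv ed E) (ha : a < n)
    (h : Reach n ed E a [y, inv y] b) : E a b := by
  obtain ⟨p₁, q₁, hp₁, hq₁, hy₁, hb, hqb⟩ := exists_of_append_singleton (u := [y]) h
  obtain ⟨p₀, q₀, hp₀, hq₀, hy₀, -, hqp⟩ := exists_of_append_singleton (u := []) hp₁
  obtain ⟨hp₀, hap⟩ := hp₀.exists_of_nil
  have hfold : E p₀ q₁ := hE.fold q₀ hq₀ p₀ hp₀ p₁ hp₁.lt q₁ hq₁ (inv y)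
    (hE.edge_inv _ hp₀ _ hq₀ _ hy₀) hy₁ hqp
  exact hE.trans a ha p₀ hp₀ b hb hap (hE.trans p₀ hp₀ q₁ hq₁ b hb hfold hqb)

theorem cancel (hE : FoldedGraph n inv ed E) (ha : a < n)
    (h : Reach n ed E a (u ++ y :: inv y :: v) c) : Reach n ed E a (u ++ v) c := by
  obtain ⟨m, hu, hrest⟩ := exists_of_append hE.refl h
  obtain ⟨m', hpair, hv⟩ := exists_of_append (u := [y, inv y]) hE.refl hrest
  exact (hu.extend hE.toFoldClosed ha hpair.lt (hpair.rel_of_pair hE hu.lt)).trans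
    hE.toFoldClosed ha hv

theorem reverse (hE : FoldedGraph n inv ed E) (ha : a < n) (h : Reach n ed E a u b) :
    Reach n ed E b (u.map inv).reverse a := by
  induction h with
  | nil hb hab => exact .nil ha (hE.symm a ha _ hb hab)
  | snoc h hq hy hr hqr ih =>
    rw [List.map_append, List.reverse_append]
    refine Reach.trans hE.toFoldClosed hr ?_ ih
    exact .snoc (.nil hq (hE.symm _ hq _ hr hqr)) h.lt (hE.edge_inv _ h.lt _ hq _ hy) h.lt
      (hE.refl _ h.lt)

end Reach

/-! ### The folded graph of the input -/

/-- `ed` is the edge relation of the graph of the input `x`, whose first word has length `e`, and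
`E` is the least relation that contains the initial fold relation and is closed under folding. -/
structure InputFolding (inv : L → L) (x : List (Option L)) (e n : ℕ) (ed : ℕ → ℕ → Symbol L)
    (E : ℕ → ℕ → Prop) : Prop where
  edge : ∀ p < n, ∀ q < n, ∀ y, ed p q = letter y ↔ IsEdge inv x n p q y
  closed : FoldClosed n ed E
  linked : ∀ p < n, ∀ q < n, Linked x e n p q → E p q
  minimal : ∀ T, FoldClosed n ed T → (∀ p < n, ∀ q < n, Linked x e n p q → T p q) →
    ∀ p < n, ∀ q < n, E p q → T p q

variable {inv : L → L} {x : List (Option L)} {e : ℕ}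

theorem Linked.symm {p q : ℕ} (h : Linked x e n p q) : Linked x e n q p := by
  rcases h with ⟨rfl, h⟩ | h | h
  · exact .inl ⟨rfl, h⟩
  · exact .inr (.inr h)
  · exact .inr (.inl h)

theorem IsEdge.symm {p q : ℕ} {y : L} (hi : Involutive inv) (h : IsEdge inv x n p q y) :
    IsEdge inv x n q p (inv y) := by
  rcases h with ⟨hq, hp, hy⟩ | ⟨hp, hq, z, hz, rfl⟩
  · exact .inr ⟨hq, hp, y, hy, rfl⟩
  · exact .inl ⟨hp, hq, by rw [hz, hi z]⟩

/-- The words `ws`, each of them followed by a separator. -/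
def terminated (ws : List (List L)) : List (Option L) := ws.flatMap fun w => w.map some ++ [none]

theorem terminated_cons (w : List L) (ws : List (List L)) :
    terminated (w :: ws) = w.map some ++ none :: terminated ws := by
  simp [terminated]

namespace InputFolding

theorem foldedGraph (h : InputFolding inv x e n ed E) (hi : Involutive inv) :
    FoldedGraph n inv ed E where
  toFoldClosed := h.closed
  refl p hp := h.linked p hp p hp (.inl ⟨rfl, hp⟩)
  symm := h.minimal (fun p q => E q p)
    ⟨fun p hp q hq r hr hpq hqr => h.closed.trans r hr q hq p hp hqr hpq,
      fun p hp p' hp' q hq q' hq' y hy hy' hpq =>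
        h.closed.fold q hq q' hq' p hp p' hp' y hy' hy hpq⟩
    fun p hp q hq hl => h.linked q hq p hp hl.symm
  edge_inv p hp q hq y hy :=
    (h.edge q hq p hp _).2 (((h.edge p hp q hq y).1 hy).symm hi)

theorem reach_of_eq_append (h : InputFolding inv x e n ed E) (hn : x.length < n)
    {pre post : List (Option L)} {w : List L} (hx : x = pre ++ (w.map some ++ post)) :
    Reach n ed E pre.length w (pre.length + w.length) := by
  have hrefl : ∀ p < n, E p p := fun p hp => h.linked p hp p hp (.inl ⟨rfl, hp⟩)
  induction w using List.reverseRecOn generalizing post with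
  | nil =>
    have hlt : pre.length < n := hn.trans_le' (by simp [hx])
    exact .nil hlt (hrefl _ hlt)
  | append_singleton w y ih =>
    have hx' : x = pre ++ (w.map some ++ some y :: post) := by simpa using hx
    have hlt : pre.length + w.length + 1 < n := by
      simp only [hx', List.length_append, List.length_cons, List.length_map] at hn
      lia
    have hedge : ed (pre.length + w.length) (pre.length + w.length + 1) = letter y := by
      refine (h.edge _ (by lia) _ hlt y).2 (.inl ⟨rfl, by lia, ?_⟩)
      rw [hx', ← List.append_assoc, List.getElem?_append_right (by simp)]
      simp
    have hreach := Reach.snoc (ih hx') hlt hedge hlt (hrefl _ hlt)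
    rwa [List.length_append, List.length_singleton, ← Nat.add_assoc]

theorem reach_zero_zero (h : InputFolding inv x e n ed E) (hn : x.length < n)
    {pre post : List (Option L)} {w : List L}
    (hx : x = pre ++ none :: (w.map some ++ none :: post)) (he : e ≤ pre.length) :
    Reach n ed E 0 w 0 := by
  have hx' : x = (pre ++ [none]) ++ (w.map some ++ none :: post) := by simpa using hx
  have hlt : pre.length + 1 + w.length + 1 < n := by
    simp only [hx', List.length_append, List.length_cons, List.length_map, List.length_nil] at hn
    lia
  have hpath := h.reach_of_eq_append hn hx'
  rw [List.length_append, List.length_singleton] at hpath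
  have hstart : E 0 (pre.length + 1) := by
    refine h.linked _ (by lia) _ (by lia) (.inr (.inr ⟨rfl, .inr ⟨_, rfl, by lia, ?_⟩⟩))
    simp [hx]
  have hend : E (pre.length + 1 + w.length) 0 := by
    refine h.linked _ (by lia) _ (by lia) (.inr (.inl ⟨rfl, .inl ⟨by lia, ?_, by lia⟩⟩))
    have hlen : pre.length + 1 + w.length = (pre ++ [none] ++ w.map some).length := by
      simp only [List.length_append, List.length_map, List.length_singleton]
    rw [hx', ← List.append_assoc, hlen, List.getElem?_append_right le_rfl]
    simp
  have h0 : Reach n ed E 0 [] (pre.length + 1) := .nil (by lia) hstart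
  exact (h0.trans h.closed (by lia) hpath).extend h.closed (by lia) (by lia) hend

theorem reach_zero_zero_of_mem (h : InputFolding inv x e n ed E) (hn : x.length < n)
    {pre : List (Option L)} {w : List L} {ws : List (List L)}
    (hx : x = pre ++ none :: terminated ws) (he : e ≤ pre.length) (hw : w ∈ ws) :
    Reach n ed E 0 w 0 := by
  induction ws generalizing pre with
  | nil => simp at hw
  | cons v ws ih =>
    rw [terminated_cons] at hx
    rcases List.mem_cons.1 hw with rfl | hw
    · exact h.reach_zero_zero hn hx he
    · refine ih (pre := pre ++ none :: v.map some) (by simpa using hx) ?_ hw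
      rw [List.length_append]
      lia

end InputFolding

/-! ### The algorithm -/

/-- The algorithm for the closest element problem: fold the graph that consists of a path for the
first word and of loops for the other words, find a shortest path from the end of the first word
to the base vertex, and write the first word and the label of this path. -/
def algorithm [DecidableEq L] (inv : L → L) : TableProg L :=
  .seq (setup inv) <| .seq foldAll <| .seq layers outputWord

variable {g : List L} {s t : Store Table (Symbol L)}

theorem SetupInv.inputFolding [DecidableEq L] (h : SetupInv n inv x g n s) (hn : 2 ≤ n) :
    InputFolding inv x g.length n ((foldAll.exec n 0 s).tab n .edge)
      (fun p q => (foldAll.exec n 0 s).tab n .fold p q = mark) := by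
  have hext := foldExt_foldAll (n := n) (s := s)
  have hedge := hext.tab (a := .edge) (by simp)
  exact
    { edge := hedge ▸ h.edge
      closed := isFolded_foldAll hn
      linked := fun p hp q hq hpq => hext.mono ((h.fold p hp q hq).2 hpq)
      minimal := fun T hT hlinked => hext.sound T (hedge ▸ hT) fun p hp q hq hpq =>
        hlinked p hp q hq ((h.fold p hp q hq).1 hpq) }

theorem Store.wordsCorrect_of_blank {R : List L → ℕ → Prop} (hlayer : ∀ j, s.arr .layer j = none)
    (hword : ∀ j, s.arr .word j = none) : s.WordsCorrect n R :=
  ⟨by simp [wordAt, hword], by simp [tab, hlayer]⟩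

theorem exec_layers_outputWord (he : e < n)
    (hstart : ∀ p < n, s.arr .start p = mark ↔ p = e) (hlayer : ∀ j, s.arr .layer j = none)
    (hword : ∀ j, s.arr .word j = none) (hdone : s.arr .done 0 = none)
    (hreach : ∃ u, s.Reach n e u 0 ∧ u.length < n) :
    ∃ u, s.Reach n e u 0 ∧
      ((ArrayProg.seq layers outputWord).exec n 0 s).out = u.reverse.map letter ++ s.out ∧
      ∀ v, s.Reach n e v 0 → u.length ≤ v.length := by
  obtain ⟨hext, hmarked⟩ := exec_layers he hstart
  obtain ⟨u₀, hu₀, hlen₀⟩ := hreach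
  have hmark₀ := hmarked u₀ 0 hu₀ hlen₀.le
  obtain ⟨u, hu, hout, hmin⟩ :=
    exec_outputWord (hext.words (Store.wordsCorrect_of_blank hlayer hword))
      (by rw [hext.arr _ (by simp) (by simp), hdone]) ⟨_, hlen₀, hmark₀⟩
  have hlen : u.length ≤ u₀.length := not_lt.1 fun h => hmin _ h hmark₀
  exact ⟨u, hu, hout.trans (by rw [hext.out]), fun v hv => not_lt.1 fun h =>
    hmin _ h (hmarked v 0 hv (by lia))⟩

theorem exec_algorithm [DecidableEq L] (inv : L → L) {rest : List (Option L)}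
    (hx : x = g.map some ++ none :: rest) (hn : x.length < n) :
    ∃ ed E, InputFolding inv x g.length n ed E ∧
      ((∃ u, Reach n ed E g.length u 0 ∧ u.length < n) →
        ∃ u, Reach n ed E g.length u 0 ∧
          ((algorithm inv).exec n 0 (.init .inp (x.map some))).out =
            (g ++ u).reverse.map letter ∧
          ∀ v, Reach n ed E g.length v 0 → u.length ≤ v.length) := by
  have hlen : g.length + 2 ≤ n := by
    simp only [hx, List.length_append, List.length_map, List.length_cons] at hn
    lia
  have hsetup := setupInv_exec_setup inv hx hn
  refine ⟨_, _, hsetup.inputFolding (by lia), fun hreach => ?_⟩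
  have hext := foldExt_foldAll (n := n) (s := (setup inv).exec n 0 (.init .inp (x.map some)))
  obtain ⟨u, hu, hout, hmin⟩ := exec_layers_outputWord (by lia)
    (fun p hp => by rw [hext.arr _ (by simp), hsetup.start]; lia)
    (by rw [hext.arr _ (by simp)]; exact hsetup.layer)
    (by rw [hext.arr _ (by simp)]; exact hsetup.word)
    (by rw [hext.arr _ (by simp)]; exact hsetup.done) hreach
  refine ⟨u, hu, hout.trans ?_, hmin⟩
  rw [hext.out, hsetup.out, List.take_of_length_le (by lia), List.reverse_append, List.map_append]

end ClosestElement

namespace ClosestElement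

open Function TableProg

/-! ### Evaluation of words -/

section Eval

variable {A : Type} {G : Type*} [Group G] (x : A → G)

/-- The inverse of a letter of the alphabet `A ∪ A⁻¹`. -/
def letterInv (y : A × Bool) : A × Bool := (y.1, !y.2)

theorem letterInv_involutive : Involutive (letterInv (A := A)) := fun y => by
  simp [letterInv]

theorem eval_eq_lift_mk (w : Word A) : eval x w = FreeGroup.lift x (FreeGroup.mk w) := by
  simp only [FreeGroup.lift_mk, eval, Bool.cond_eq_ite]

theorem eval_nil : eval x [] = 1 := rfl

theorem eval_append (u v : Word A) : eval x (u ++ v) = eval x u * eval x v := by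
  simp only [eval_eq_lift_mk, ← FreeGroup.mul_mk, map_mul]

theorem eval_reverse_map_letterInv (w : Word A) :
    eval x (w.map letterInv).reverse = (eval x w)⁻¹ := by
  rw [eval_eq_lift_mk, eval_eq_lift_mk, ← map_inv, FreeGroup.inv_mk]
  rfl

theorem eval_letterInv (y : A × Bool) : eval x [letterInv y] = (eval x [y])⁻¹ :=
  eval_reverse_map_letterInv x [y]

/-- The element of the group that is represented by the part of the input after the last
separator. -/
def evalLast (l : List (Option (A × Bool))) : G :=
  l.foldl (fun g o => o.elim 1 fun y => g * eval x [y]) 1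

theorem evalLast_map_some (w : Word A) : evalLast x (w.map some) = eval x w := by
  induction w using List.reverseRecOn with
  | nil => rfl
  | append_singleton w y ih =>
    rw [eval_append, ← ih]
    simp [evalLast]

theorem evalLast_append_none (l l' : List (Option (A × Bool))) :
    evalLast x (l ++ none :: l') = evalLast x l' := by
  simp [evalLast]

theorem evalLast_take_succ {l : List (Option (A × Bool))} {p : ℕ} {o : Option (A × Bool)}
    (h : l[p]? = some o) :
    evalLast x (l.take (p + 1)) = o.elim 1 fun y => evalLast x (l.take p) * eval x [y] := by
  rw [List.take_add_one, h]
  simp [evalLast]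

theorem evalLast_take_add (w : Word A) (l : List (Option (A × Bool))) (k : ℕ) :
    evalLast x ((w.map some ++ none :: l).take (w.length + 1 + k)) = evalLast x (l.take k) := by
  have hlen : w.length + 1 + k = (w.map some).length + (k + 1) := by
    rw [List.length_map]
    lia
  rw [hlen, List.take_length_add_append, List.take_succ_cons, evalLast_append_none]

theorem eq_or_exists_of_getElem?_append_none {L : Type} {w : List L} {l : List (Option L)} {p : ℕ}
    (h : (w.map some ++ none :: l)[p]? = some none) :
    p = w.length ∨ ∃ k, p = w.length + 1 + k ∧ l[k]? = some none := by
  rcases lt_trichotomy p w.length with hp | hp | hp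
  · rw [List.getElem?_append_left (by simpa using hp)] at h
    simp [List.getElem?_map] at h
  · exact .inl hp
  · obtain ⟨k, rfl⟩ := Nat.exists_eq_add_of_lt hp
    refine .inr ⟨k, by lia, ?_⟩
    rw [List.getElem?_append_right (by rw [List.length_map]; lia), List.length_map,
      show w.length + k + 1 - w.length = k + 1 by lia] at h
    simpa using h

theorem exists_mem_evalLast_take_terminated {ws : List (Word A)} {p : ℕ}
    (hp : (terminated ws)[p]? = some none) :
    ∃ w ∈ ws, evalLast x ((terminated ws).take p) = eval x w := by
  induction ws generalizing p with
  | nil => simp [terminated] at hp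
  | cons v ws ih =>
    rw [terminated_cons] at hp ⊢
    rcases eq_or_exists_of_getElem?_append_none hp with rfl | ⟨k, rfl, hk⟩
    · refine ⟨v, List.mem_cons_self, ?_⟩
      rw [List.take_left' (List.length_map _), evalLast_map_some]
    · obtain ⟨w, hw, heval⟩ := ih hk
      exact ⟨w, List.mem_cons_of_mem _ hw, by rw [evalLast_take_add, heval]⟩

end Eval

/-! ### The folded graph and the subgroup -/

theorem Instance.encode_eq {A : Type} (I : Instance A) :
    I.encode = I.elt.map some ++ none :: terminated I.gens :=
  terminated_cons I.elt I.gens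

theorem Instance.length_elt_lt {A : Type} (I : Instance A) : I.elt.length < I.encode.length := by
  rw [I.encode_eq, List.length_append, List.length_map, List.length_cons]
  lia

section Folding

variable {A : Type} {G : Type*} [Group G] {x : A → G} {I : Instance A} {n : ℕ}
  {ed : ℕ → ℕ → Symbol (A × Bool)} {E : ℕ → ℕ → Prop} {a c p q : ℕ} {u v : Word A}

theorem IsBase.evalLast_mem (h : IsBase I.encode I.elt.length n p) :
    evalLast x (I.encode.take p) ∈ I.subgroup x := by
  rcases h with ⟨-, hsep, hne⟩ | ⟨p', rfl, -, hsep⟩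
  · rw [I.encode_eq] at hsep ⊢
    obtain ⟨k, rfl, hk⟩ := (eq_or_exists_of_getElem?_append_none hsep).resolve_left hne
    obtain ⟨w, hw, heval⟩ := exists_mem_evalLast_take_terminated x hk
    rw [evalLast_take_add, heval]
    exact Subgroup.subset_closure ⟨w, hw, rfl⟩
  · rw [evalLast_take_succ x hsep]
    exact one_mem _

namespace InputFolding

theorem evalLast_edge (h : InputFolding letterInv I.encode I.elt.length n ed E) (x : A → G)
    {y : A × Bool} (hp : p < n) (hq : q < n) (hy : ed p q = letter y) :
    evalLast x (I.encode.take q) = evalLast x (I.encode.take p) * eval x [y] := by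
  rcases (h.edge p hp q hq y).1 hy with ⟨rfl, -, hsymbol⟩ | ⟨rfl, -, z, hsymbol, rfl⟩
  · simp [evalLast_take_succ x hsymbol]
  · simp [evalLast_take_succ x hsymbol, eval_letterInv]

-- The vertex `p` stands for the coset `H * evalLast x (I.encode.take p)`: the edges respect this
-- assignment, and the relation of having equal cosets contains the initial fold relation.
theorem evalLast_mul_inv_mem (h : InputFolding letterInv I.encode I.elt.length n ed E)
    (hp : p < n) (hq : q < n) (hpq : E p q) :
    evalLast x (I.encode.take p) * (evalLast x (I.encode.take q))⁻¹ ∈ I.subgroup x := by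
  refine h.minimal (fun p q => evalLast x (I.encode.take p) * (evalLast x (I.encode.take q))⁻¹ ∈
    I.subgroup x) ⟨fun p _ q _ r _ hpq hqr => ?_, fun p hp p' hp' q hq q' hq' y hy hy' hmem => ?_⟩
    ?_ p hp q hq hpq
  · simpa only [mul_assoc, inv_mul_cancel_left] using mul_mem hpq hqr
  · rw [h.evalLast_edge x hp hp' hy, h.evalLast_edge x hq hq' hy']
    simpa [mul_assoc] using hmem
  · rintro p - q - (⟨rfl, -⟩ | ⟨rfl, hbase⟩ | ⟨rfl, hbase⟩)
    · simp
    · simpa [evalLast] using hbase.evalLast_mem (x := x)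
    · simpa [evalLast] using hbase.evalLast_mem (x := x)

theorem mul_eval_mul_inv_mem (h : InputFolding letterInv I.encode I.elt.length n ed E)
    (ha : a < n) (hu : Reach n ed E a u c) :
    evalLast x (I.encode.take a) * eval x u * (evalLast x (I.encode.take c))⁻¹ ∈
      I.subgroup x := by
  induction hu with
  | nil hc hac => simpa [eval_nil] using h.evalLast_mul_inv_mem ha hc hac
  | snoc hu hq hy hr hqr ih =>
    have hmem := mul_mem ih (h.evalLast_mul_inv_mem (x := x) hq hr hqr)
    rw [h.evalLast_edge x hu.lt hq hy] at hmem
    rw [eval_append]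
    simpa [mul_assoc] using hmem

theorem eval_elt_append_mem (h : InputFolding letterInv I.encode I.elt.length n ed E)
    (hn : I.encode.length < n) (hu : Reach n ed E I.elt.length u 0) :
    eval x (I.elt ++ u) ∈ I.subgroup x := by
  have hmem := h.mul_eval_mul_inv_mem (x := x) (I.length_elt_lt.trans hn) hu
  rw [I.encode_eq, List.take_left' (List.length_map _), evalLast_map_some, ← eval_append] at hmem
  simpa [evalLast] using hmem

theorem exists_reach_of_mem (h : InputFolding letterInv I.encode I.elt.length n ed E)
    (hn : I.encode.length < n) {g : G} (hg : g ∈ I.subgroup x) :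
    ∃ w, Reach n ed E 0 w 0 ∧ eval x w = g := by
  have hE := h.foldedGraph letterInv_involutive
  have h0 : 0 < n := hn.pos
  induction hg using Subgroup.closure_induction with
  | mem g hg =>
    obtain ⟨w, hw, rfl⟩ := hg
    exact ⟨w, h.reach_zero_zero_of_mem hn I.encode_eq (List.length_map _).ge hw, rfl⟩
  | one => exact ⟨[], .nil h0 (hE.refl 0 h0), rfl⟩
  | mul g g' _ _ hg hg' =>
    obtain ⟨u, hu, rfl⟩ := hg
    obtain ⟨v, hv, rfl⟩ := hg'
    exact ⟨u ++ v, hu.trans h.closed h0 hv, eval_append _ _ _⟩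
  | inv g _ hg =>
    obtain ⟨u, hu, rfl⟩ := hg
    exact ⟨_, hu.reverse hE h0, eval_reverse_map_letterInv _ _⟩

theorem reach_of_red (h : InputFolding letterInv I.encode I.elt.length n ed E) (ha : a < n)
    (huv : FreeGroup.Red u v) (hu : Reach n ed E a u c) : Reach n ed E a v c := by
  induction huv with
  | refl => exact hu
  | tail _ hstep ih =>
    cases hstep with
    | not => exact ih.cancel (h.foldedGraph letterInv_involutive) ha

theorem reach_map_letterInv_elt (h : InputFolding letterInv I.encode I.elt.length n ed E)
    (hn : I.encode.length < n) :
    Reach n ed E I.elt.length (I.elt.map letterInv).reverse 0 := by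
  have hpath := h.reach_of_eq_append hn (pre := []) I.encode_eq
  rw [List.length_nil, Nat.zero_add] at hpath
  exact hpath.reverse (h.foldedGraph letterInv_involutive) hn.pos

end InputFolding

end Folding

/-! ### Word length in a free group -/

section FreeGroupBasis

variable {A : Type} {G : Type*} [Group G] (b : FreeGroupBasis A G)

theorem repr_eval (w : Word A) : b.repr (eval (fun i => b i) w) = FreeGroup.mk w := by
  have hlift : b.repr.toMonoidHom.comp (FreeGroup.lift fun i => b i) = MonoidHom.id _ :=
    FreeGroup.ext_hom _ _ fun a => by simp
  rw [eval_eq_lift_mk]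
  exact DFunLike.congr_fun hlift _

theorem wordLength_eval_le (x : A → G) (w : Word A) : wordLength x (eval x w) ≤ w.length :=
  Nat.sInf_le ⟨w, rfl, rfl⟩

theorem length_reduce_le_wordLength [DecidableEq A] (w : Word A) :
    (FreeGroup.reduce w).length ≤ wordLength (fun i => b i) (eval (fun i => b i) w) := by
  refine le_csInf ⟨w.length, w, rfl, rfl⟩ ?_
  rintro _ ⟨v, hv, rfl⟩
  have hmk : FreeGroup.mk v = FreeGroup.mk w := by rw [← repr_eval b, ← repr_eval b, hv]
  rw [← FreeGroup.toWord_mk, ← hmk]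
  exact FreeGroup.norm_mk_le

theorem InputFolding.exists_reach_length_le_wordDist {I : Instance A} {n : ℕ}
    {ed : ℕ → ℕ → Symbol (A × Bool)} {E : ℕ → ℕ → Prop}
    (h : InputFolding letterInv I.encode I.elt.length n ed E) (hn : I.encode.length < n) {g : G}
    (hg : g ∈ I.subgroup fun i => b i) :
    ∃ v, Reach n ed E I.elt.length v 0 ∧
      v.length ≤ wordDist (fun i => b i) (eval (fun i => b i) I.elt) g := by
  classical
  obtain ⟨w, hw, rfl⟩ := h.exists_reach_of_mem hn hg
  have hlt : I.elt.length < n := I.length_elt_lt.trans hn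
  refine ⟨_, h.reach_of_red hlt FreeGroup.reduce.red
    ((h.reach_map_letterInv_elt hn).trans h.closed hlt hw), ?_⟩
  rw [wordDist, ← eval_reverse_map_letterInv, ← eval_append]
  exact length_reduce_le_wordLength b _

theorem algorithm_isSolution [DecidableEq A] (I : Instance A) :
    ∃ w : Word A, ((algorithm letterInv).exec (I.encode.length + 1) 0
        (.init .inp (I.encode.map some))).out = w.reverse.map letter ∧
      IsSolution (fun i => b i) I w := by
  have hn := Nat.lt_succ_self I.encode.length
  obtain ⟨ed, E, h, hexec⟩ := exec_algorithm letterInv I.encode_eq hn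
  obtain ⟨u, hu, hout, hmin⟩ := hexec ⟨_, h.reach_map_letterInv_elt hn, by
    simpa using I.length_elt_lt.trans hn⟩
  refine ⟨I.elt ++ u, hout, h.eval_elt_append_mem hn hu, fun g hg => ?_⟩
  obtain ⟨v, hv, hle⟩ := h.exists_reach_length_le_wordDist b hn hg
  calc wordDist (fun i => b i) (eval (fun i => b i) I.elt) (eval (fun i => b i) (I.elt ++ u))
      = wordLength (fun i => b i) (eval (fun i => b i) u) := by
        rw [wordDist, eval_append, inv_mul_cancel_left]
    _ ≤ u.length := wordLength_eval_le _ u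
    _ ≤ v.length := hmin v hv
    _ ≤ wordDist (fun i => b i) (eval (fun i => b i) I.elt) g := hle

end FreeGroupBasis

end ClosestElement

theorem mainTheorem8_general {A : Type} [Finite A] {G : Type*} [Group G]
    (b : FreeGroupBasis A G) : ClosestElement.SolvableInPolyTime (fun i => b i) := by
  classical
  choose f hf hsol using ClosestElement.algorithm_isSolution b
  exact ⟨f, ClosestElement.ArrayProg.computableInPolyTime _ f some
    ((Option.some_injective _).comp (Option.some_injective _))
    (ClosestElement.algorithm ClosestElement.letterInv) .inp hf, hsol⟩

/-- In a free group of finite rank, with the generators of a free basis, the closest element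
problem is solvable in polynomial time. -/
theorem mainTheorem8 {G : Type*} [Group G] (r : ℕ) (b : FreeGroupBasis (Fin r) G) :
    ClosestElement.SolvableInPolyTime (fun i => b i) := by
  exact mainTheorem8_general b
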